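/- Let $\mathbb H=\{z\in\mathbb C:\operatorname{Im} z>0\}$ and, for $z\in\mathbb H$ and $s\in\mathbb R$, write $q^s=e^{2\pi i s z}$. Let $$\Theta_2(z)=\sum_{n\in\mathbb Z+\frac12}q^{n^2/2},\qquad \Theta_3(z)=\sum_{n\in\mathbb Z}q^{n^2/2},\qquad \Theta_4(z)=\sum_{n\in\mathbb Z}(-1)^nq^{n^2/2},\qquad \Delta(z)=q\prod_{n\ge1}(1-q^n)^{24},$$ and $$\varphi=\frac{\Theta_4^{12}\,(\Theta_3^{12}+\Theta_2^{12})}{\Delta}.$$ 1. $\varphi$ is a weakly holomorphic modular form of weight $0$ for $\Gamma(2)$; that is, $\varphi$ is holomorphic on $\mathbb H$, $\varphi(\gamma z)=\varphi(z)$ for all $\gamma\in\Gamma(2)$, and $\varphi$ is meromorphic at the cusps (for every $\gamma\in SL_2(\mathbb Z)$ there is $n\ge 0$ such that $q^{n}\varphi(\gamma z)$ is bounded as $\operatorname{Im} z\to\infty$). 2. For all $z\in\mathbb H$, $\varphi(z+1)-\varphi(z)=\varphi(-1/z)\,i^{-2}$. 3. For every $r>\sqrt2$ the function $t\mapsto\varphi(it)e^{-\pi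 r^2t}$ is integrable on $(0,\infty)$, and the function $$a(r)=-4i\,\sin^2\!\left(\frac{\pi r^2}{2}\right)\int_0^\infty\varphi(it)\,e^{-\pi r^2t}\,dt\qquad(r>\sqrt2)$$ has a unique extension to $[0,\infty)$ that is real-analytic (in a neighbourhood of each point of $[0,\infty)$). Denote the extension by $a$ as well. 4. The function $f_+(x)=i\,a(\|x\|)$, $x\in\mathbb R^4$, is a real-valued (radial) Schwartz function on $\mathbb R^4$, and $\widehat{f_+}=f_+$, where $\widehat f(\xi)=\int_{\mathbb R^4}f(x)e^{-2\pi i x\cdot\xi}\,dx$. 5. The sign radius of $f_+$, defined by $r_{f_+}=\inf\{M\ge0: f_+(x)\ge0\text{ for all }x\in\mathbb R^4\text{ with }\|x\|\ge M\}$, equals $\sqrt2$. -/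

import Mathlib

open scoped MatrixGroups ModularForm Manifold SchwartzMap FourierTransform

noncomputable section

namespace FourDimEigenfunction

/-- `Θ₂(z) = ∑_{n ∈ ℤ + 1/2} q^{n²/2}`, where `q^s = exp(2πi s z)`. -/
def Theta2 (z : ℂ) : ℂ :=
  ∑' n : ℤ, Complex.exp (Real.pi * Complex.I * ((n : ℂ) + 1 / 2) ^ 2 * z)

/-- `Θ₃(z) = ∑_{n ∈ ℤ} q^{n²/2}`. -/
def Theta3 (z : ℂ) : ℂ :=
  ∑' n : ℤ, Complex.exp (Real.pi * Complex.I * (n : ℂ) ^ 2 * z)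

/-- `Θ₄(z) = ∑_{n ∈ ℤ} (-1)^n q^{n²/2}`. -/
def Theta4 (z : ℂ) : ℂ :=
  ∑' n : ℤ, (-1 : ℂ) ^ n * Complex.exp (Real.pi * Complex.I * (n : ℂ) ^ 2 * z)

/-- The modular discriminant `Δ(z) = η(z)^24 = q ∏_{n ≥ 1} (1 - q^n)^24`, as a function of a
complex variable. -/
def Delta (z : ℂ) : ℂ := ModularForm.eta z ^ 24

/-- On the upper half-plane, `Delta` is the discriminant of Mathlib. -/
theorem Delta_coe (z : UpperHalfPlane) : Delta z = ModularForm.discriminant z := rfl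

/-- `φ = Θ₄¹² (Θ₃¹² + Θ₂¹²) / Δ`. -/
def phi (z : ℂ) : ℂ :=
  Theta4 z ^ 12 * (Theta3 z ^ 12 + Theta2 z ^ 12) / Delta z

/-- Weakly holomorphic modular forms of weight `k` for a subgroup `Γ` of finite index in `SL(2, ℤ)`:
holomorphic on the upper half-plane, invariant under the weight `k` action of `Γ`, and
meromorphic at every cusp. The last condition says that for each `γ ∈ SL(2, ℤ)` some
`q^n · (f ∣[k] γ)` stays bounded as `Im z → ∞`, that is, the expansion of `f ∣[k] γ` in
fractional powers of `q` has only finitely many terms with negative exponent. -/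
structure IsWeaklyHolomorphicModularForm (Γ : Subgroup SL(2, ℤ)) (k : ℤ)
    (f : UpperHalfPlane → ℂ) : Prop where
  holo : MDifferentiable 𝓘(ℂ) 𝓘(ℂ) f
  slash_eq : ∀ γ ∈ Γ, f ∣[k] γ = f
  meromorphic_at_cusps : ∀ γ : SL(2, ℤ), ∃ n : ℕ,
    UpperHalfPlane.IsBoundedAtImInfty fun z : UpperHalfPlane =>
      Complex.exp (2 * Real.pi * Complex.I * n * z) * (f ∣[k] γ) z

/-- The integrand `φ(it) e^{-π r² t}`. -/
def laplaceIntegrand (r t : ℝ) : ℂ :=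
  phi (Complex.I * t) * Complex.exp (-Real.pi * r ^ 2 * t)

/-- `a` is an analytic function of `r` on a neighbourhood of `[0, ∞)` such that
`a(r) = -4i sin²(π r² / 2) ∫₀^∞ φ(it) e^{-π r² t} dt` for `r > √2`. -/
structure IsAnalyticContinuation (a : ℝ → ℂ) : Prop where
  analytic : AnalyticOnNhd ℝ a (Set.Ici 0)
  eq_integral : ∀ r : ℝ, √2 < r →
    a r = -4 * Complex.I * (Real.sin (Real.pi * r ^ 2 / 2) : ℂ) ^ 2 *
      ∫ t in Set.Ioi (0 : ℝ), laplaceIntegrand r t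

/-- The sign radius `r_f = inf {M ≥ 0 : f(x) ≥ 0 whenever ‖x‖ ≥ M}`. -/
def signRadius {E : Type*} [NormedAddCommGroup E] (f : E → ℝ) : ℝ :=
  sInf {M : ℝ | 0 ≤ M ∧ ∀ x : E, M ≤ ‖x‖ → 0 ≤ f x}

end FourDimEigenfunction

end

noncomputable section

namespace FourDimEigenfunction

open Complex Filter Topology Set MeasureTheory
open scoped Matrix

/-! ### Theta constants and the discriminant -/

/-! Up to sign, the three quotients `Θᵢ¹² Θⱼ¹² / Δ` have weight zero and are permuted by `SL(2, ℤ)`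
like the nonzero vectors of `𝔽₂²` (`thetaQuot_smul`). Since `φ` is a difference of two of them, it
is invariant under `Γ(2)`, and with `ψ(z) = φ(-1/z)` one has `φ(z+1) = φ(z) - ψ(z)` and `ψ(z+1) =
-ψ(z)`. The crucial asymmetry at `i∞` is that `φ` grows like `e^{2πy}`, whereas `ψ` contains `Θ₂¹²`
and is `O(e^{-πy})`.

Put `s = r²`. Since `-4 sin²(πs/2) = e^{πis} + e^{-πis} - 2`, the expression defining `a` is a
combination of integrals of `φ(z ± 1) e^{πisz}` and `φ(z) e^{πisz}` over vertical lines. Pushing the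
shifted contours through `i` leaves two arcs of the unit circle from `±1` to `i`, the segment from
`0` to `i`, and the ray from `i` to `i∞`. On the ray the integrand is the second difference `φ(z+1)
- 2φ(z) + φ(z-1) = -2ψ(z)`. On all four pieces the weight is governed by `ψ` near its cusp, so the
integrals converge for `Re s > -1/4`, are analytic there, and decay rapidly with all derivatives
(`IsGaussianWeight`, `eigenProfile_eq_laplace`). This gives the continuation and the Schwartz
property.

On `ℝ⁴` the Fourier transform sends `e^{πi‖x‖²z}` to `-z⁻² e^{πi‖ξ‖²(-1/z)}`. The map `z ↦ -1/z`
exchanges the two arcs, and the segment with the ray, and the weights match by the relations for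
`ψ`. Hence the eigenvalue is `+1`.

For `s > 2` the function is `4 sin²(πs/2)` times the Laplace transform of `φ(it) ≥ 0`, hence
nonnegative. At `s = 2` that transform blows up like `1/(s-2)` because `φ(it)` has exact order
`e^{2πt}`, while `sin²` vanishes to order two. The zero is therefore simple with positive slope, and
the function is negative just below `s = 2`. -/

theorem Theta3_eq_jacobiTheta₂ (z : ℂ) : Theta3 z = jacobiTheta₂ 0 z :=
  jacobiTheta_eq_jacobiTheta₂ z

theorem Theta4_eq_jacobiTheta₂ (z : ℂ) : Theta4 z = jacobiTheta₂ (1 / 2) z := by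
  refine tsum_congr fun n => ?_
  rw [jacobiTheta₂_term, Complex.exp_add]
  congr 1
  rw [← exp_pi_mul_I, ← Complex.exp_int_mul]
  ring_nf

theorem Theta2_eq_jacobiTheta₂ (z : ℂ) :
    Theta2 z = exp (Real.pi * I * z / 4) * jacobiTheta₂ (z / 2) z := by
  rw [jacobiTheta₂, ← tsum_mul_left]
  refine tsum_congr fun n => ?_
  rw [jacobiTheta₂_term, ← Complex.exp_add]
  ring_nf

theorem differentiableAt_Theta2 {z : ℂ} (hz : 0 < z.im) : DifferentiableAt ℂ Theta2 z := by
  rw [funext Theta2_eq_jacobiTheta₂]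
  have h := (hasFDerivAt_jacobiTheta₂ (z / 2) hz).differentiableAt
  have h' : DifferentiableAt ℂ (fun w : ℂ => (w / 2, w)) z := by fun_prop
  exact (by fun_prop : DifferentiableAt ℂ (fun w : ℂ => exp (Real.pi * I * w / 4)) z).mul
    (DifferentiableAt.comp (f := fun w : ℂ => (w / 2, w)) z h h')

theorem differentiableAt_Theta3 {z : ℂ} (hz : 0 < z.im) : DifferentiableAt ℂ Theta3 z := by
  rw [funext Theta3_eq_jacobiTheta₂]
  exact differentiableAt_jacobiTheta₂_snd 0 hz

theorem differentiableAt_Theta4 {z : ℂ} (hz : 0 < z.im) : DifferentiableAt ℂ Theta4 z := by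
  rw [funext Theta4_eq_jacobiTheta₂]
  exact differentiableAt_jacobiTheta₂_snd _ hz

theorem differentiableAt_Delta {z : ℂ} (hz : 0 < z.im) : DifferentiableAt ℂ Delta z :=
  (ModularForm.differentiableAt_eta_of_mem_upperHalfPlaneSet hz).pow 24

theorem Delta_ne_zero {z : ℂ} (hz : 0 < z.im) : Delta z ≠ 0 :=
  ModularForm.discriminant_ne_zero ⟨z, hz⟩

theorem exp_pi_mul_I_mul_int_sq (n : ℤ) :
    exp (Real.pi * I * (n : ℂ) ^ 2) = (-1) ^ n := by
  rw [← exp_pi_mul_I, ← Complex.exp_int_mul, Complex.exp_eq_exp_iff_exists_int]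
  obtain ⟨k, hk⟩ := Int.even_mul_succ_self (n - 1)
  refine ⟨k, ?_⟩
  have : (n : ℂ) ^ 2 - n = 2 * k := by
    have : n ^ 2 - n = 2 * k := by linarith [hk, mul_comm (n - 1) (n - 1 + 1)]
    exact_mod_cast this
  linear_combination (Real.pi * I : ℂ) * this

theorem Theta3_add_one (z : ℂ) : Theta3 (z + 1) = Theta4 z := by
  refine tsum_congr fun n => ?_
  rw [← exp_pi_mul_I_mul_int_sq, ← Complex.exp_add]
  ring_nf

theorem Theta4_add_one (z : ℂ) : Theta4 (z + 1) = Theta3 z := by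
  refine tsum_congr fun n => ?_
  rw [mul_add, mul_one, Complex.exp_add, exp_pi_mul_I_mul_int_sq, mul_left_comm, ← mul_zpow]
  simp

theorem Theta2_add_one (z : ℂ) : Theta2 (z + 1) = exp (Real.pi * I / 4) * Theta2 z := by
  rw [Theta2, Theta2, ← tsum_mul_left]
  refine tsum_congr fun n => ?_
  rw [← Complex.exp_add, Complex.exp_eq_exp_iff_exists_int]
  obtain ⟨k, hk⟩ := Int.even_mul_succ_self n
  refine ⟨k, ?_⟩
  have : (n : ℂ) * (n + 1) = 2 * k := by exact_mod_cast hk.trans (two_mul k).symm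
  linear_combination (Real.pi * I : ℂ) * this

/-- The multiplier `e^{πi/4}` has twelfth power `e^{3πi} = -1`; this is the sign that `thetaQuot`
has to absorb. -/
theorem Theta2_add_one_pow (z : ℂ) : Theta2 (z + 1) ^ 12 = -Theta2 z ^ 12 := by
  rw [Theta2_add_one, mul_pow, ← Complex.exp_nat_mul]
  have : ((12 : ℕ) : ℂ) * (Real.pi * I / 4) = Real.pi * I + 2 * Real.pi * I := by
    push_cast; ring
  rw [this, Complex.exp_periodic, exp_pi_mul_I]
  ring

/-- The twelfth power removes the square-root branch from the theta functional equation, leaving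
`(-iz)⁶ = -z⁶`. -/
theorem neg_I_mul_cpow_half_pow {z : ℂ} (hz : z ≠ 0) :
    ((-I * z) ^ (1 / 2 : ℂ)) ^ 12 = -z ^ 6 := by
  have h : -I * z ≠ 0 := mul_ne_zero (neg_ne_zero.mpr I_ne_zero) hz
  rw [← Complex.cpow_nat_mul]
  have : ((12 : ℕ) : ℂ) * (1 / 2) = ((6 : ℕ) : ℂ) := by norm_num
  rw [this, Complex.cpow_natCast, mul_pow, neg_pow, show (6 : ℕ) = 4 + 2 from rfl, pow_add I,
    I_pow_four, I_sq]
  ring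

theorem pow_twelve_of_functional_equation {z a b : ℂ} (hz : 0 < z.im)
    (h : a = 1 / (-I * z) ^ (1 / 2 : ℂ) * b) : b ^ 12 = -z ^ 6 * a ^ 12 := by
  have hz0 : z ≠ 0 := fun h => by simp [h] at hz
  rw [h, mul_pow, div_pow, neg_I_mul_cpow_half_pow hz0]
  field_simp

theorem Theta3_neg_inv {z : ℂ} (hz : 0 < z.im) :
    Theta3 (-1 / z) ^ 12 = -z ^ 6 * Theta3 z ^ 12 := by
  apply pow_twelve_of_functional_equation hz
  rw [Theta3_eq_jacobiTheta₂, Theta3_eq_jacobiTheta₂, jacobiTheta₂_functional_equation 0 z]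
  simp

theorem Theta2_neg_inv {z : ℂ} (hz : 0 < z.im) :
    Theta2 (-1 / z) ^ 12 = -z ^ 6 * Theta4 z ^ 12 := by
  have hz0 : z ≠ 0 := fun h => by simp [h] at hz
  apply pow_twelve_of_functional_equation hz
  -- The characteristic `1/2` is sent to `1/(2z)`, which is the `Θ₂` argument at `-1/z` up to sign;
  -- evenness of `jacobiTheta₂` in its first variable settles the sign.
  rw [Theta4_eq_jacobiTheta₂, Theta2_eq_jacobiTheta₂, jacobiTheta₂_functional_equation _ z,
    mul_assoc, ← jacobiTheta₂_neg_left (-1 / z / 2)]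
  ring_nf

theorem im_neg_one_div (z : ℂ) : (-1 / z).im = z.im / normSq z := by
  simp [neg_div, Complex.inv_im]

theorem im_neg_one_div_pos {z : ℂ} (hz : 0 < z.im) : 0 < (-1 / z).im := by
  rw [im_neg_one_div]
  exact div_pos hz (normSq_pos.mpr fun h => by simp [h] at hz)

theorem neg_one_div_neg_one_div (z : ℂ) : -1 / (-1 / z) = z := by
  rw [div_div_eq_mul_div]; simp

theorem Theta4_neg_inv {z : ℂ} (hz : 0 < z.im) :
    Theta4 (-1 / z) ^ 12 = -z ^ 6 * Theta2 z ^ 12 := by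
  have hz0 : z ≠ 0 := fun h => by simp [h] at hz
  have h := Theta2_neg_inv (im_neg_one_div_pos hz)
  rw [neg_one_div_neg_one_div] at h
  rw [h]
  field_simp

theorem Delta_add_one {z : ℂ} (hz : 0 < z.im) : Delta (z + 1) = Delta z := by
  have hz' : 0 < (z + 1).im := by simpa using hz
  have h := ModularForm.discriminant_eq_q_prod ⟨z, hz⟩
  have h' := ModularForm.discriminant_eq_q_prod ⟨z + 1, hz'⟩
  have hq : ∀ n, ModularForm.eta_q n (z + 1) = ModularForm.eta_q n z := fun n => by
    rw [ModularForm.eta_q_eq_pow, ModularForm.eta_q_eq_pow, mul_add, mul_one,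
      Complex.exp_periodic]
  have hp : Function.Periodic.qParam 1 (z + 1) = Function.Periodic.qParam 1 z := by
    simp only [Function.Periodic.qParam, ofReal_one, div_one]
    rw [mul_add, mul_one, Complex.exp_periodic]
  rw [← Delta_coe] at h h'
  simp only [hq] at h'
  exact h'.trans ((congrArg₂ _ hp rfl).trans h.symm)

theorem Delta_neg_inv {z : ℂ} (hz : 0 < z.im) : Delta (-1 / z) = z ^ 12 * Delta z := by
  have hz0 : z ≠ 0 := fun h => by simp [h] at hz
  have h := congrFun ModularForm.discriminant_S_invariant ⟨z, hz⟩
  rw [ModularForm.SL_slash_apply, UpperHalfPlane.modular_S_smul, ModularGroup.denom_S,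
    ← Delta_coe, ← Delta_coe] at h
  have e : (-z)⁻¹ = -1 / z := by rw [neg_div, one_div, inv_neg]
  simp only [e] at h
  rw [← h, zpow_neg, mul_left_comm, zpow_ofNat, mul_inv_cancel₀ (pow_ne_zero _ hz0), mul_one]

/-! ### Three weight zero quotients permuted by the modular group -/

/-- The weight zero quotients `Θᵢ¹² Θⱼ¹² / Δ`, up to sign, indexed by the nonzero vectors of
`𝔽₂²` so that `SL(2, ℤ)` acts through its action on row vectors. -/
def thetaQuot (v : Fin 2 → ZMod 2) (z : ℂ) : ℂ :=
  if v 0 = 0 then if v 1 = 0 then 0 else Theta3 z ^ 12 * Theta4 z ^ 12 / Delta z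
  else if v 1 = 0 then Theta2 z ^ 12 * Theta3 z ^ 12 / Delta z
  else -(Theta2 z ^ 12 * Theta4 z ^ 12 / Delta z)

theorem phi_eq_thetaQuot (z : ℂ) : phi z = thetaQuot ![0, 1] z - thetaQuot ![1, 1] z := by
  simp [phi, thetaQuot]
  ring

theorem ZMod_two_eq_zero_or_one (a : ZMod 2) : a = 0 ∨ a = 1 := by
  revert a; decide

theorem thetaQuot_add_one (v : Fin 2 → ZMod 2) {z : ℂ} (hz : 0 < z.im) :
    thetaQuot v (z + 1) = thetaQuot ![v 0, v 0 + v 1] z := by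
  simp only [thetaQuot, Theta2_add_one_pow, Theta3_add_one, Theta4_add_one, Delta_add_one hz]
  rcases ZMod_two_eq_zero_or_one (v 0) with h0 | h0 <;>
    rcases ZMod_two_eq_zero_or_one (v 1) with h1 | h1 <;>
    simp [h0, h1, CharTwo.add_self_eq_zero] <;> ring

/-- Two factors `-z⁶` from the theta constants cancel the `z¹²` of `Δ`, while `Θ₂` and `Θ₄` are
exchanged. -/
theorem thetaQuot_neg_inv (v : Fin 2 → ZMod 2) {z : ℂ} (hz : 0 < z.im) :
    thetaQuot v (-1 / z) = thetaQuot ![v 1, v 0] z := by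
  have hz0 : z ≠ 0 := fun h => by simp [h] at hz
  have hD := Delta_ne_zero hz
  simp only [thetaQuot, Theta2_neg_inv hz, Theta3_neg_inv hz, Theta4_neg_inv hz, Delta_neg_inv hz]
  rcases ZMod_two_eq_zero_or_one (v 0) with h0 | h0 <;>
    rcases ZMod_two_eq_zero_or_one (v 1) with h1 | h1 <;>
    simp [h0, h1] <;> field_simp

/-- The right action of `SL(2, ℤ)` on row vectors over `𝔽₂`. -/
def rowAct (v : Fin 2 → ZMod 2) (γ : SL(2, ℤ)) : Fin 2 → ZMod 2 :=
  v ᵥ* (γ : Matrix (Fin 2) (Fin 2) ℤ).map (Int.castRingHom (ZMod 2))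

theorem rowAct_mul (v : Fin 2 → ZMod 2) (γ δ : SL(2, ℤ)) :
    rowAct v (γ * δ) = rowAct (rowAct v γ) δ := by
  simp only [rowAct, Matrix.SpecialLinearGroup.coe_mul, Matrix.map_mul, Matrix.vecMul_vecMul]

theorem rowAct_one (v : Fin 2 → ZMod 2) : rowAct v 1 = v := by
  simp [rowAct, Matrix.map_one]

theorem rowAct_of_mem_Gamma_two (v : Fin 2 → ZMod 2) {γ : SL(2, ℤ)}
    (hγ : γ ∈ CongruenceSubgroup.Gamma 2) : rowAct v γ = v := by
  obtain ⟨h00, h01, h10, h11⟩ := CongruenceSubgroup.Gamma_mem.mp hγ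
  have : (γ : Matrix (Fin 2) (Fin 2) ℤ).map (Int.castRingHom (ZMod 2)) = 1 := by
    ext i j
    fin_cases i <;> fin_cases j <;> simpa
  rw [rowAct, this, Matrix.vecMul_one]

/-- By induction over the generators `S` and `T`. Right multiplication on row vectors turns
composition of transformations into products in the correct order. -/
theorem thetaQuot_smul (γ : SL(2, ℤ)) (v : Fin 2 → ZMod 2) (z : UpperHalfPlane) :
    thetaQuot v ↑(γ • z) = thetaQuot (rowAct v γ) z := by
  have hγ : γ ∈ Subgroup.closure {ModularGroup.S, ModularGroup.T} := by
    simp [SpecialLinearGroup.SL2Z_generators]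
  induction hγ using Subgroup.closure_induction generalizing v z with
  | mem γ h =>
    rcases h with rfl | rfl
    · rw [UpperHalfPlane.modular_S_smul]
      have e : (-(z : ℂ))⁻¹ = -1 / z := by rw [neg_div, one_div, inv_neg]
      simp only [e]
      rw [thetaQuot_neg_inv v z.2]
      congr 1
      ext i
      fin_cases i <;> simp [rowAct, ModularGroup.S, Matrix.vecMul, dotProduct]
    · rw [UpperHalfPlane.modular_T_smul]
      have e : (((1 : ℝ) +ᵥ z : UpperHalfPlane) : ℂ) = z + 1 := by
        rw [UpperHalfPlane.coe_vadd]; push_cast; ring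
      rw [e, thetaQuot_add_one v z.2]
      congr 1
      ext i
      fin_cases i <;> simp [rowAct, ModularGroup.T, Matrix.vecMul, dotProduct]
  | one => rw [one_smul, rowAct_one]
  | mul γ δ _ _ hγ hδ => rw [mul_smul, hγ, hδ, rowAct_mul]
  | inv γ _ hγ =>
    have h := hγ (rowAct v γ⁻¹) (γ⁻¹ • z)
    rwa [smul_inv_smul, ← rowAct_mul, inv_mul_cancel, rowAct_one, eq_comm] at h

theorem phi_smul (γ : SL(2, ℤ)) (z : UpperHalfPlane) :
    phi ↑(γ • z) = thetaQuot (rowAct ![0, 1] γ) z - thetaQuot (rowAct ![1, 1] γ) z := by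
  rw [phi_eq_thetaQuot, thetaQuot_smul, thetaQuot_smul]

theorem phi_slash (γ : SL(2, ℤ)) (z : UpperHalfPlane) :
    ((fun z : UpperHalfPlane => phi z) ∣[(0 : ℤ)] γ) z = phi ↑(γ • z) := by
  rw [ModularForm.SL_slash_apply]
  simp

theorem differentiableAt_phi {z : ℂ} (hz : 0 < z.im) : DifferentiableAt ℂ phi z :=
  (((differentiableAt_Theta4 hz).pow 12).mul (((differentiableAt_Theta3 hz).pow 12).add
    ((differentiableAt_Theta2 hz).pow 12))).div (differentiableAt_Delta hz) (Delta_ne_zero hz)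

/-! ### Growth of the theta constants -/

theorem exists_norm_jacobiTheta₂_zero_le :
    ∃ C : ℝ, ∀ z : ℂ, 1 / 2 ≤ z.im → ∀ x : ℝ, ‖jacobiTheta₂ x z‖ ≤ C := by
  have hs : Summable fun n => jacobiTheta₂_term n 0 (I / 2) :=
    (summable_jacobiTheta₂_term_iff _ _).mpr (by simp)
  refine ⟨_, fun z hz x => tsum_of_norm_bounded hs.norm.hasSum fun n => ?_⟩
  rw [norm_jacobiTheta₂_term, norm_jacobiTheta₂_term, Real.exp_le_exp]
  simp only [ofReal_im, mul_zero, sub_zero, zero_im]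
  have h : (I / 2).im = 1 / 2 := by simp
  rw [h]
  have : 0 ≤ Real.pi * (n : ℝ) ^ 2 := by positivity
  nlinarith

/-- Once `e^{πiz/4}` is factored out, the terms have norm `e^{-π(n²+n) Im z}` with `n² + n ≥ 0`, so
they are largest at `z = i/2`. -/
theorem exists_norm_Theta2_le :
    ∃ C : ℝ, ∀ z : ℂ, 1 / 2 ≤ z.im → ‖Theta2 z‖ ≤ C * Real.exp (-Real.pi * z.im / 4) := by
  have hs : Summable fun n => jacobiTheta₂_term n (I / 4) (I / 2) :=
    (summable_jacobiTheta₂_term_iff _ _).mpr (by simp)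
  refine ⟨∑' n, ‖jacobiTheta₂_term n (I / 4) (I / 2)‖, fun z hz => ?_⟩
  rw [Theta2_eq_jacobiTheta₂, norm_mul, mul_comm]
  refine mul_le_mul (tsum_of_norm_bounded hs.norm.hasSum fun n => ?_) (le_of_eq ?_)
    (norm_nonneg _) (tsum_nonneg fun n => norm_nonneg _)
  · rw [norm_jacobiTheta₂_term, norm_jacobiTheta₂_term, Real.exp_le_exp]
    have h : (I / 2).im = 1 / 2 := by simp
    have h' : (I / 4).im = 1 / 4 := by simp
    have h2 : (z / 2).im = z.im / 2 := by simp
    rw [h, h', h2]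
    have hn : (0 : ℝ) ≤ (n : ℝ) ^ 2 + n := by
      have : 0 ≤ n ^ 2 + n := by nlinarith [sq_nonneg (2 * n + 1)]
      exact_mod_cast this
    have := mul_nonneg Real.pi_pos.le hn
    nlinarith
  · rw [Complex.norm_exp]
    congr 1
    have : (Real.pi * I * z / 4 : ℂ) = ((Real.pi / 4 : ℝ) : ℂ) * (I * z) := by push_cast; ring
    rw [this, re_ofReal_mul, I_mul_re]
    ring

theorem exists_norm_Theta_le :
    ∃ C : ℝ, 0 < C ∧ ∀ z : ℂ, 1 / 2 ≤ z.im →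
      ‖Theta2 z‖ ≤ C * Real.exp (-Real.pi * z.im / 4) ∧ ‖Theta3 z‖ ≤ C ∧ ‖Theta4 z‖ ≤ C := by
  obtain ⟨C, hC⟩ := exists_norm_jacobiTheta₂_zero_le
  obtain ⟨D, hD⟩ := exists_norm_Theta2_le
  refine ⟨max (max C D) 1, by positivity, fun z hz => ⟨(hD z hz).trans ?_, ?_, ?_⟩⟩
  · gcongr
    exact (le_max_right _ _).trans (le_max_left _ _)
  · rw [Theta3_eq_jacobiTheta₂]
    exact ((hC z hz 0).trans (le_max_left _ _)).trans (le_max_left _ _)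
  · rw [Theta4_eq_jacobiTheta₂]
    have := hC z hz (1 / 2)
    push_cast at this
    exact (this.trans (le_max_left _ _)).trans (le_max_left _ _)

theorem exists_norm_inv_Delta_le :
    ∃ A C : ℝ, 0 < C ∧ ∀ z : ℂ, 0 < z.im → A ≤ z.im →
      ‖(Delta z)⁻¹‖ ≤ C * Real.exp (2 * Real.pi * z.im) := by
  obtain ⟨C, hC, h⟩ := ModularForm.exp_isBigO_discriminant.exists_pos
  obtain ⟨A, hA⟩ := (UpperHalfPlane.atImInfty_mem _).mp h.bound
  refine ⟨A, C, hC, fun z hz hAz => ?_⟩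
  have := hA ⟨z, hz⟩ hAz
  simp only [mem_ofPred_eq, ← Delta_coe] at this
  rw [Real.norm_of_nonneg (Real.exp_pos _).le] at this
  change Real.exp (-2 * Real.pi * z.im) ≤ C * ‖Delta z‖ at this
  have hD : 0 < ‖Delta z‖ := norm_pos_iff.mpr (Delta_ne_zero hz)
  rw [norm_inv, inv_le_iff_one_le_mul₀ hD]
  calc (1 : ℝ) = Real.exp (-2 * Real.pi * z.im) * Real.exp (2 * Real.pi * z.im) := by
        rw [← Real.exp_add]; ring_nf; simp
    _ ≤ C * ‖Delta z‖ * Real.exp (2 * Real.pi * z.im) := by gcongr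
    _ = _ := by ring

theorem exists_norm_inv_Delta_le_strip :
    ∃ C : ℝ, 0 < C ∧ ∀ z : ℂ, |z.re| ≤ 1 → 1 / 2 ≤ z.im →
      ‖(Delta z)⁻¹‖ ≤ C * Real.exp (2 * Real.pi * z.im) := by
  obtain ⟨A, C, hC, h⟩ := exists_norm_inv_Delta_le
  have hK : IsCompact (Icc (-1 : ℝ) 1 ×ℂ Icc (1 / 2 : ℝ) A) := isCompact_Icc.reProdIm isCompact_Icc
  have hcont : ContinuousOn (fun z => (Delta z)⁻¹) (Icc (-1 : ℝ) 1 ×ℂ Icc (1 / 2 : ℝ) A) := by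
    intro z hz
    have hz : 0 < z.im := by linarith [(mem_reProdIm.mp hz).2.1]
    exact ((differentiableAt_Delta hz).continuousAt.inv₀ (Delta_ne_zero hz)).continuousWithinAt
  obtain ⟨B, hB⟩ := hK.exists_bound_of_continuousOn hcont
  refine ⟨max B C, lt_max_of_lt_right hC, fun z hre him => ?_⟩
  rcases le_or_gt A z.im with hA | hA
  · exact (h z (by linarith) hA).trans (by gcongr; exact le_max_right _ _)
  · refine ((hB z ⟨abs_le.mp hre, him, hA.le⟩).trans (le_max_left B C)).trans ?_
    exact le_mul_of_one_le_right (le_max_of_le_right hC.le)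
      (Real.one_le_exp (by have := Real.pi_pos; positivity))

/-- Both quotients with `v 0 = 1` contain `Θ₂¹² = O(e^{-3πy})`, which beats the `e^{2πy}` of `1/Δ`.
This is the source of the decay of `ψ`. -/
theorem thetaQuot_norm_le {C D : ℝ} {z : ℂ} (hC : 0 < C) (hz : 0 < z.im)
    (h : ‖Theta2 z‖ ≤ C * Real.exp (-Real.pi * z.im / 4) ∧ ‖Theta3 z‖ ≤ C ∧ ‖Theta4 z‖ ≤ C)
    (hD : ‖(Delta z)⁻¹‖ ≤ D * Real.exp (2 * Real.pi * z.im)) (v : Fin 2 → ZMod 2) :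
    ‖thetaQuot v z‖ ≤ C ^ 24 * D * Real.exp (2 * Real.pi * z.im) ∧
      (v 0 = 1 → ‖thetaQuot v z‖ ≤ C ^ 24 * D * Real.exp (-Real.pi * z.im)) := by
  obtain ⟨h2, h3, h4⟩ := h
  have h3 : ‖Theta3 z ^ 12‖ ≤ C ^ 12 := by rw [norm_pow]; gcongr
  have h4 : ‖Theta4 z ^ 12‖ ≤ C ^ 12 := by rw [norm_pow]; gcongr
  have h2 : ‖Theta2 z ^ 12‖ ≤ C ^ 12 * Real.exp (-3 * Real.pi * z.im) := by
    rw [norm_pow]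
    refine (pow_le_pow_left₀ (norm_nonneg _) h2 12).trans (le_of_eq ?_)
    rw [mul_pow, ← Real.exp_nat_mul]
    ring_nf
  have hD0 : 0 ≤ D := nonneg_of_mul_nonneg_left ((norm_nonneg _).trans hD) (Real.exp_pos _)
  have key : ∀ b : ℂ, ‖b‖ ≤ C ^ 12 → ‖Theta2 z ^ 12 * b / Delta z‖ ≤
      C ^ 24 * D * Real.exp (-Real.pi * z.im) := fun b hb => by
    rw [div_eq_mul_inv, norm_mul, norm_mul]
    calc _ ≤ C ^ 12 * Real.exp (-3 * Real.pi * z.im) * C ^ 12 *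
          (D * Real.exp (2 * Real.pi * z.im)) := by gcongr
      _ = C ^ 24 * D * (Real.exp (-3 * Real.pi * z.im) * Real.exp (2 * Real.pi * z.im)) := by ring
      _ = _ := by rw [← Real.exp_add]; ring_nf
  have hexp : Real.exp (-Real.pi * z.im) ≤ Real.exp (2 * Real.pi * z.im) :=
    Real.exp_le_exp.mpr (by nlinarith [Real.pi_pos])
  have key' : ∀ b : ℂ, ‖b‖ ≤ C ^ 12 → ‖Theta2 z ^ 12 * b / Delta z‖ ≤
      C ^ 24 * D * Real.exp (2 * Real.pi * z.im) := fun b hb => (key b hb).trans (by gcongr)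
  rcases ZMod_two_eq_zero_or_one (v 0) with h0 | h0 <;>
    rcases ZMod_two_eq_zero_or_one (v 1) with h1 | h1
  · simp [thetaQuot, h0, h1]
    positivity
  · have : ‖Theta3 z ^ 12 * Theta4 z ^ 12 / Delta z‖ ≤
        C ^ 24 * D * Real.exp (2 * Real.pi * z.im) := by
      rw [div_eq_mul_inv, norm_mul, norm_mul]
      calc _ ≤ C ^ 12 * C ^ 12 * (D * Real.exp (2 * Real.pi * z.im)) := by gcongr
        _ = _ := by ring
    simpa [thetaQuot, h0, h1] using this
  · simpa [thetaQuot, h0, h1, -norm_mul, -norm_div] using And.intro (key' _ h3) (key _ h3)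
  · simpa [thetaQuot, h0, h1, -norm_mul, -norm_div] using And.intro (key' _ h4) (key _ h4)

theorem isBoundedAtImInfty_exp_mul_thetaQuot (v : Fin 2 → ZMod 2) :
    UpperHalfPlane.IsBoundedAtImInfty fun z : UpperHalfPlane =>
      exp (2 * Real.pi * I * (1 : ℕ) * z) * thetaQuot v z := by
  obtain ⟨C, hC, h⟩ := exists_norm_Theta_le
  obtain ⟨A, D, hD, hA⟩ := exists_norm_inv_Delta_le
  refine UpperHalfPlane.isBoundedAtImInfty_iff.mpr ⟨C ^ 24 * D, max A (1 / 2), fun z hz => ?_⟩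
  have hb := (thetaQuot_norm_le hC z.2 (h z ((le_max_right _ _).trans hz))
    (hA z z.2 ((le_max_left _ _).trans hz)) v).1
  rw [norm_mul, Complex.norm_exp]
  have : (2 * Real.pi * I * (1 : ℕ) * z : ℂ).re = -(2 * Real.pi * (z : ℂ).im) := by
    simp
  rw [this]
  calc _ ≤ Real.exp (-(2 * Real.pi * (z : ℂ).im)) *
        (C ^ 24 * D * Real.exp (2 * Real.pi * (z : ℂ).im)) := by gcongr
    _ = C ^ 24 * D * (Real.exp (-(2 * Real.pi * (z : ℂ).im)) *
        Real.exp (2 * Real.pi * (z : ℂ).im)) := by ring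
    _ = _ := by rw [← Real.exp_add]; simp

theorem isWeaklyHolomorphicModularForm_phi :
    IsWeaklyHolomorphicModularForm (CongruenceSubgroup.Gamma 2) 0
      (fun z : UpperHalfPlane => phi z) where
  holo := by
    rw [UpperHalfPlane.mdifferentiable_iff]
    refine DifferentiableOn.congr (f := phi)
      (fun z hz => (differentiableAt_phi hz).differentiableWithinAt) fun z hz => ?_
    simp [UpperHalfPlane.ofComplex_apply_of_im_pos hz]
  slash_eq γ hγ := by
    ext z
    rw [phi_slash, phi_smul, rowAct_of_mem_Gamma_two _ hγ, rowAct_of_mem_Gamma_two _ hγ,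
      ← phi_eq_thetaQuot]
  meromorphic_at_cusps γ := by
    -- One power of `q` suffices at every cusp, since each quotient is `O(e^{2πy})`.
    refine ⟨1, ?_⟩
    simp only [phi_slash, phi_smul, mul_sub]
    exact (isBoundedAtImInfty_exp_mul_thetaQuot _).sub (isBoundedAtImInfty_exp_mul_thetaQuot _)

/-! ### The transform `ψ(z) = φ(-1/z)` -/

/-- The function `ψ = Θ₂¹² (Θ₃¹² + Θ₄¹²) / Δ`, equal to `φ(-1/z)` on the upper half-plane. -/
def psi (z : ℂ) : ℂ := thetaQuot ![1, 0] z - thetaQuot ![1, 1] z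

theorem phi_neg_inv {z : ℂ} (hz : 0 < z.im) : phi (-1 / z) = psi z := by
  rw [phi_eq_thetaQuot, thetaQuot_neg_inv _ hz, thetaQuot_neg_inv _ hz]
  rfl

theorem psi_add_one {z : ℂ} (hz : 0 < z.im) : psi (z + 1) = -psi z := by
  rw [psi, thetaQuot_add_one _ hz, thetaQuot_add_one _ hz]
  simp [psi, CharTwo.add_self_eq_zero]

theorem phi_add_one {z : ℂ} (hz : 0 < z.im) : phi (z + 1) = phi z - psi z := by
  rw [phi_eq_thetaQuot, phi_eq_thetaQuot, thetaQuot_add_one _ hz, thetaQuot_add_one _ hz]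
  simp [psi, CharTwo.add_self_eq_zero]

theorem phi_add_one_sub {z : ℂ} (hz : 0 < z.im) :
    phi (z + 1) - phi z = phi (-1 / z) * I ^ (-2 : ℤ) := by
  rw [phi_add_one hz, phi_neg_inv hz]
  have : (I : ℂ) ^ (-2 : ℤ) = -1 := by
    rw [zpow_neg, show (2 : ℤ) = ((2 : ℕ) : ℤ) from rfl, zpow_natCast, I_sq]; norm_num
  rw [this]
  ring

/-- `φ` has period 2, because `ψ` changes sign under `z ↦ z + 1`. This makes the second difference
of `φ` equal to `-2ψ`. -/
theorem phi_sub_one {z : ℂ} (hz : 0 < z.im) : phi (z - 1) = phi (z + 1) := by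
  have hz' : 0 < (z - 1).im := by simpa using hz
  have h := phi_add_one hz'
  have h' := psi_add_one hz'
  rw [sub_add_cancel] at h h'
  rw [phi_add_one hz, h', h]
  ring

theorem differentiableAt_psi {z : ℂ} (hz : 0 < z.im) : DifferentiableAt ℂ psi z := by
  have h : DifferentiableAt ℂ (fun w => phi (-1 / w)) z :=
    DifferentiableAt.comp (g := phi) z (differentiableAt_phi (im_neg_one_div_pos hz))
      (by have : z ≠ 0 := fun h => by simp [h] at hz
          fun_prop (disch := assumption))
  refine h.congr_of_eventuallyEq ?_
  filter_upwards [(isOpen_lt continuous_const Complex.continuous_im).mem_nhds hz] with w hw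
  exact (phi_neg_inv hw).symm

theorem exists_norm_phi_psi_le :
    ∃ C : ℝ, 0 < C ∧ ∀ z : ℂ, |z.re| ≤ 1 → 1 / 2 ≤ z.im →
      ‖phi z‖ ≤ C * Real.exp (2 * Real.pi * z.im) ∧ ‖psi z‖ ≤ C * Real.exp (-Real.pi * z.im) := by
  obtain ⟨C, hC, h⟩ := exists_norm_Theta_le
  obtain ⟨D, hD, hA⟩ := exists_norm_inv_Delta_le_strip
  refine ⟨2 * (C ^ 24 * D), by positivity, fun z hre him => ?_⟩
  have hb := thetaQuot_norm_le hC (by linarith) (h z him) (hA z hre him)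
  constructor
  · rw [phi_eq_thetaQuot]
    refine (norm_sub_le _ _).trans ?_
    linarith [(hb ![0, 1]).1, (hb ![1, 1]).1]
  · refine (norm_sub_le _ _).trans ?_
    linarith [(hb ![1, 0]).2 rfl, (hb ![1, 1]).2 rfl]

/-! ### Values on the imaginary axis -/

theorem Theta2_I_mul (t : ℝ) :
    Theta2 (I * t) = (∑' n : ℤ, Real.exp (-Real.pi * (n + 1 / 2) ^ 2 * t) : ℝ) := by
  rw [ofReal_tsum]
  refine tsum_congr fun n => ?_
  push_cast
  congr 1
  linear_combination (Real.pi * ((n : ℂ) + 1 / 2) ^ 2 * t) * I_mul_I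

theorem Theta3_I_mul (t : ℝ) :
    Theta3 (I * t) = (∑' n : ℤ, Real.exp (-Real.pi * n ^ 2 * t) : ℝ) := by
  rw [ofReal_tsum]
  refine tsum_congr fun n => ?_
  push_cast
  congr 1
  linear_combination (Real.pi * (n : ℂ) ^ 2 * t) * I_mul_I

theorem Theta4_I_mul (t : ℝ) :
    Theta4 (I * t) = (∑' n : ℤ, (-1) ^ n * Real.exp (-Real.pi * n ^ 2 * t) : ℝ) := by
  rw [ofReal_tsum]
  refine tsum_congr fun n => ?_
  push_cast
  congr 2
  linear_combination (Real.pi * (n : ℂ) ^ 2 * t) * I_mul_I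

/-- On the imaginary axis `q` and its fractional powers are real, so conjugation fixes each factor
of the product. -/
theorem eta_I_mul_im {t : ℝ} (ht : 0 < t) : (ModularForm.eta (I * t)).im = 0 := by
  rw [← Complex.conj_eq_iff_im]
  have hz : I * (t : ℂ) ∈ UpperHalfPlane.upperHalfPlaneSet := by
    simpa [UpperHalfPlane.upperHalfPlaneSet] using ht
  have hm := ModularForm.multipliableLocallyUniformlyOn_eta.multipliable hz
  rw [ModularForm.eta, map_mul, hm.map_tprod (starRingEnd ℂ) continuous_conj]
  congr 1
  · rw [Function.Periodic.qParam, ← Complex.exp_conj]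
    congr 1
    simp only [map_div₀, map_mul, conj_I, conj_ofReal, map_ofNat]
    push_cast
    ring
  · refine tprod_congr fun n => ?_
    rw [ModularForm.eta_q_eq_cexp, map_sub, map_one, ← Complex.exp_conj]
    congr 2
    simp only [map_mul, map_add, conj_I, conj_ofReal, map_ofNat, map_natCast, map_one]
    ring

theorem exists_Delta_I_mul {t : ℝ} (ht : 0 < t) : ∃ d : ℝ, 0 < d ∧ Delta (I * t) = d := by
  have h : ((ModularForm.eta (I * t)).re : ℂ) = ModularForm.eta (I * t) :=
    Complex.ext rfl (by simp [eta_I_mul_im ht])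
  have h0 : Delta (I * t) = ((ModularForm.eta (I * t)).re ^ 24 : ℝ) := by
    push_cast
    rw [h, Delta]
  refine ⟨_, lt_of_le_of_ne (by positivity) fun h1 => ?_, h0⟩
  rw [← h1] at h0
  exact Delta_ne_zero (z := I * t) (by simpa using ht) (by simpa using h0)

/-- The theta constants are real on the imaginary axis and enter with even exponents, over a
positive `Δ`. -/
theorem exists_phi_I_mul {t : ℝ} (ht : 0 < t) : ∃ a : ℝ, 0 ≤ a ∧ phi (I * t) = a := by
  obtain ⟨d, hd, h⟩ := exists_Delta_I_mul ht
  refine ⟨_, ?_, by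
    rw [phi, h, Theta2_I_mul, Theta3_I_mul, Theta4_I_mul]
    norm_cast⟩
  positivity

theorem phi_I_mul_re_nonneg {t : ℝ} (ht : 0 < t) : 0 ≤ (phi (I * t)).re := by
  obtain ⟨a, ha, h⟩ := exists_phi_I_mul ht
  simpa [h] using ha

theorem ofReal_phi_I_mul_re {t : ℝ} (ht : 0 < t) : ((phi (I * t)).re : ℂ) = phi (I * t) := by
  obtain ⟨a, ha, h⟩ := exists_phi_I_mul ht
  simp [h]

theorem half_le_norm_jacobiTheta {z : ℂ} (hz : 2 ≤ z.im) : 1 / 2 ≤ ‖jacobiTheta z‖ := by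
  have h := norm_jacobiTheta_sub_one_le (τ := z) (by linarith)
  -- `π Im z ≥ 6`, so `e^{π Im z} ≥ 7`.
  have hx : Real.exp (-Real.pi * z.im) ≤ 1 / 7 := by
    rw [neg_mul, Real.exp_neg, one_div]
    apply inv_anti₀ (by norm_num)
    have := Real.add_one_le_exp (Real.pi * z.im)
    nlinarith [Real.pi_gt_three]
  have h0 := Real.exp_pos (-Real.pi * z.im)
  have h1 : 2 / (1 - Real.exp (-Real.pi * z.im)) * Real.exp (-Real.pi * z.im) ≤ 1 / 2 := by
    rw [div_mul_eq_mul_div, div_le_iff₀ (by linarith)]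
    linarith
  have h2 := norm_sub_norm_le (1 : ℂ) (jacobiTheta z)
  rw [norm_one, norm_sub_rev] at h2
  linarith

theorem exists_norm_Delta_le :
    ∃ A : ℝ, ∀ z : ℂ, 0 < z.im → A ≤ z.im → ‖Delta z‖ ≤ 2 * Real.exp (-2 * Real.pi * z.im) := by
  have h := ModularForm.tendsto_atImInfty_tprod_one_sub_eta_q_pow.norm.eventually_le_const
    (u := 2) (by simp)
  obtain ⟨A, hA⟩ := (UpperHalfPlane.atImInfty_mem _).mp h
  refine ⟨A, fun z hz hAz => ?_⟩
  have h1 := hA ⟨z, hz⟩ hAz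
  have h2 := ModularForm.discriminant_eq_q_prod ⟨z, hz⟩
  rw [← Delta_coe] at h2
  have hq : ‖Function.Periodic.qParam 1 z‖ = Real.exp (-2 * Real.pi * z.im) := by
    simp [Function.Periodic.qParam, Complex.norm_exp]
  change Delta z = Function.Periodic.qParam 1 z * _ at h2
  rw [h2, norm_mul, hq, mul_comm]
  exact mul_le_mul_of_nonneg_right h1 (Real.exp_pos _).le

theorem exists_le_phi_I_mul_re :
    ∃ c T : ℝ, 0 < c ∧ 1 ≤ T ∧ ∀ t, T ≤ t → c * Real.exp (2 * Real.pi * t) ≤ (phi (I * t)).re := by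
  obtain ⟨A, hA⟩ := exists_norm_Delta_le
  -- A factor `2⁻¹²` comes from each of `Θ₃¹²` and `Θ₄¹²`, and `1/2` from the upper bound on `Δ`;
  -- the `Θ₂¹²` term is dropped as nonnegative.
  refine ⟨(1 / 2) ^ 25, max A 2, by positivity, le_max_of_le_right (by norm_num), fun t ht => ?_⟩
  have ht2 : 2 ≤ t := (le_max_right _ _).trans ht
  have ht0 : 0 < t := by linarith
  have him : (I * (t : ℂ)).im = t := by simp
  have h3 : 1 / 2 ≤ ‖Theta3 (I * t)‖ := half_le_norm_jacobiTheta (by rwa [him])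
  have h4 : 1 / 2 ≤ ‖Theta4 (I * t)‖ := by
    rw [← Theta3_add_one]
    exact half_le_norm_jacobiTheta (by simpa [him] using ht2)
  obtain ⟨d, hd, hD⟩ := exists_Delta_I_mul ht0
  have hd2 := hA (I * t) (by simpa using ht0) (by rw [him]; exact (le_max_left _ _).trans ht)
  rw [phi, hD]
  rw [hD, him, norm_real, Real.norm_of_nonneg hd.le] at hd2
  rw [Theta3_I_mul, norm_real, Real.norm_eq_abs] at h3
  rw [Theta4_I_mul, norm_real, Real.norm_eq_abs] at h4
  rw [Theta2_I_mul, Theta3_I_mul, Theta4_I_mul]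
  generalize (∑' n : ℤ, Real.exp (-Real.pi * (n + 1 / 2) ^ 2 * t) : ℝ) = a at *
  generalize (∑' n : ℤ, Real.exp (-Real.pi * n ^ 2 * t) : ℝ) = b at *
  generalize (∑' n : ℤ, (-1) ^ n * Real.exp (-Real.pi * n ^ 2 * t) : ℝ) = e at *
  norm_cast
  have hb : (1 / 2 : ℝ) ^ 12 ≤ b ^ 12 := by
    rw [← Even.pow_abs (by decide : Even 12) b]; gcongr
  have he : (1 / 2 : ℝ) ^ 12 ≤ e ^ 12 := by
    rw [← Even.pow_abs (by decide : Even 12) e]; gcongr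
  have ha : 0 ≤ a ^ 12 := by positivity
  rw [le_div_iff₀ hd]
  calc (1 / 2 : ℝ) ^ 25 * Real.exp (2 * Real.pi * t) * d
      ≤ (1 / 2 : ℝ) ^ 25 * Real.exp (2 * Real.pi * t) * (2 * Real.exp (-2 * Real.pi * t)) := by
        gcongr
    _ = (1 / 2 : ℝ) ^ 24 * (Real.exp (2 * Real.pi * t) * Real.exp (-2 * Real.pi * t)) := by ring
    _ = (1 / 2 : ℝ) ^ 12 * (1 / 2 : ℝ) ^ 12 := by rw [← Real.exp_add]; ring_nf; simp
    _ ≤ e ^ 12 * (b ^ 12 + a ^ 12) := by gcongr; linarith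

/-! ### Superpositions of complex Gaussians along a curve -/

/-- A curve `z` in the upper half-plane and a weight `h`, parametrised by `y > y₀`, such that
`h` decays exponentially while `z` tends to infinity, or to the real line, only polynomially. -/
structure IsGaussianWeight (y₀ : ℝ) (z h : ℝ → ℂ) : Prop where
  half_le : 1 / 2 ≤ y₀
  continuousOn_curve : ContinuousOn z (Ioi y₀)
  continuousOn_weight : ContinuousOn h (Ioi y₀)
  le_im : ∀ y ∈ Ioi y₀, 1 / (2 * y) ≤ (z y).im
  norm_curve_le : ∀ y ∈ Ioi y₀, ‖z y‖ ≤ 2 * y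
  abs_re_le : ∀ y ∈ Ioi y₀, |(z y).re| ≤ 1
  norm_weight_le : ∃ (C : ℝ) (k : ℕ), 0 ≤ C ∧
    ∀ y ∈ Ioi y₀, ‖h y‖ ≤ C * y ^ k * Real.exp (-Real.pi * y)

/-- The superposition `∫ h(y) e^{π i s z(y)} dy`. -/
def gaussianSuperposition (y₀ : ℝ) (z h : ℝ → ℂ) (s : ℂ) : ℂ :=
  ∫ y in Ioi y₀, h y * exp (Real.pi * I * s * z y)

theorem integrableOn_exp_neg_half (y₀ : ℝ) :
    IntegrableOn (fun y : ℝ => Real.exp (-(1 / 2) * y)) (Ioi y₀) :=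
  integrableOn_exp_mul_Ioi (by norm_num) _

/-- The factor `e^{πy/2}` is the worst growth of the Gaussian when `Re s > -1/4`. With `y^k ≤ k!
e^y` the total exponent is `1 - π/2 < -1/2`. -/
theorem pow_mul_exp_le (k : ℕ) {y : ℝ} (hy : 0 ≤ y) :
    y ^ k * Real.exp (-Real.pi * y) * Real.exp (Real.pi * y / 2) ≤
      k.factorial * Real.exp (-(1 / 2) * y) := by
  have h := Real.pow_div_factorial_le_exp y hy k
  rw [div_le_iff₀ (by positivity), mul_comm] at h
  calc _ ≤ k.factorial * Real.exp y * Real.exp (-Real.pi * y) * Real.exp (Real.pi * y / 2) := by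
        gcongr
    _ = k.factorial * Real.exp (y + -Real.pi * y + Real.pi * y / 2) := by
        rw [Real.exp_add, Real.exp_add]; ring
    _ ≤ _ := by
        gcongr
        nlinarith [Real.pi_gt_three]

theorem norm_exp_pi_mul_I_mul (s w : ℂ) :
    ‖exp (Real.pi * I * s * w)‖ = Real.exp (-Real.pi * (s.re * w.im + s.im * w.re)) := by
  rw [Complex.norm_exp]
  congr 1
  simp
  ring

namespace IsGaussianWeight

variable {y₀ : ℝ} {z h : ℝ → ℂ}

theorem pos (H : IsGaussianWeight y₀ z h) {y : ℝ} (hy : y ∈ Ioi y₀) : 0 < y := by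
  have := H.half_le
  rw [mem_Ioi] at hy
  linarith

theorem im_pos (H : IsGaussianWeight y₀ z h) {y : ℝ} (hy : y ∈ Ioi y₀) : 0 < (z y).im :=
  lt_of_lt_of_le (by have := H.pos hy; positivity) (H.le_im y hy)

/-- Each derivative in `s` brings down a factor `z(y)`, so closure under it handles all derivatives
at once. -/
theorem mul_curve (H : IsGaussianWeight y₀ z h) :
    IsGaussianWeight y₀ z (fun y => h y * z y) where
  half_le := H.half_le
  continuousOn_curve := H.continuousOn_curve
  continuousOn_weight := H.continuousOn_weight.mul H.continuousOn_curve
  le_im := H.le_im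
  norm_curve_le := H.norm_curve_le
  abs_re_le := H.abs_re_le
  norm_weight_le := by
    obtain ⟨C, k, hC, hb⟩ := H.norm_weight_le
    refine ⟨2 * C, k + 1, by positivity, fun y hy => ?_⟩
    have := H.pos hy
    rw [norm_mul]
    calc _ ≤ C * y ^ k * Real.exp (-Real.pi * y) * (2 * y) :=
          mul_le_mul (hb y hy) (H.norm_curve_le y hy) (norm_nonneg _) (by positivity)
      _ = _ := by ring

theorem mul_curve_pow (H : IsGaussianWeight y₀ z h) (n : ℕ) :
    IsGaussianWeight y₀ z (fun y => h y * z y ^ n) := by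
  induction n with
  | zero => simpa using H
  | succ n ih => simpa [pow_succ, mul_assoc] using ih.mul_curve

/-- As `Im z ≤ 2y`, the margin `-1/4` costs at most half of the exponential decay of the weight.
Room to the left of `s = 0` gives analyticity on a neighbourhood of `[0, ∞)`. -/
theorem norm_exp_le (H : IsGaussianWeight y₀ z h) {y : ℝ} (hy : y ∈ Ioi y₀) {s : ℂ}
    (hs : -(1 / 4) < s.re) :
    ‖exp (Real.pi * I * s * z y)‖ ≤ Real.exp (Real.pi * |s.im|) * Real.exp (Real.pi * y / 2) := by
  rw [norm_exp_pi_mul_I_mul, ← Real.exp_add, Real.exp_le_exp]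
  have h1 := (Complex.abs_im_le_norm (z y)).trans (H.norm_curve_le y hy)
  rw [abs_of_pos (H.im_pos hy)] at h1
  have h2 : -(s.im * (z y).re) ≤ |s.im| := by
    refine (neg_le_abs _).trans ?_
    rw [abs_mul]
    exact mul_le_of_le_one_right (abs_nonneg _) (H.abs_re_le y hy)
  have h3 : -(s.re * (z y).im) ≤ y / 2 := by nlinarith [H.im_pos hy]
  nlinarith [Real.pi_pos]

theorem aestronglyMeasurable_integrand (H : IsGaussianWeight y₀ z h) (s : ℂ) :
    AEStronglyMeasurable (fun y => h y * exp (Real.pi * I * s * z y))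
      (volume.restrict (Ioi y₀)) := by
  refine ContinuousOn.aestronglyMeasurable ?_ measurableSet_Ioi
  exact H.continuousOn_weight.mul (continuousOn_const.mul H.continuousOn_curve).cexp

theorem exists_integrable_bound (H : IsGaussianWeight y₀ z h) (B : ℝ) :
    ∃ b : ℝ → ℝ, IntegrableOn b (Ioi y₀) ∧ ∀ y ∈ Ioi y₀, ∀ s : ℂ, -(1 / 4) < s.re →
      |s.im| ≤ B → ‖h y * exp (Real.pi * I * s * z y)‖ ≤ b y := by
  obtain ⟨C, k, hC, hb⟩ := H.norm_weight_le
  refine ⟨_, ((integrableOn_exp_neg_half y₀).const_mul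
    (C * Real.exp (Real.pi * B) * k.factorial)), fun y hy s hs hB => ?_⟩
  have hy0 := (H.pos hy).le
  rw [norm_mul]
  have hpi := Real.pi_pos
  calc _ ≤ C * y ^ k * Real.exp (-Real.pi * y) *
        (Real.exp (Real.pi * B) * Real.exp (Real.pi * y / 2)) := by
        refine mul_le_mul (hb y hy) ((H.norm_exp_le hy hs).trans ?_) (norm_nonneg _)
          (by positivity)
        gcongr
    _ = C * Real.exp (Real.pi * B) *
        (y ^ k * Real.exp (-Real.pi * y) * Real.exp (Real.pi * y / 2)) := by ring
    _ ≤ C * Real.exp (Real.pi * B) * (k.factorial * Real.exp (-(1 / 2) * y)) := by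
        exact mul_le_mul_of_nonneg_left (pow_mul_exp_le k hy0) (by positivity)
    _ = _ := by ring

theorem integrableOn_integrand (H : IsGaussianWeight y₀ z h) {s : ℂ} (hs : -(1 / 4) < s.re) :
    IntegrableOn (fun y => h y * exp (Real.pi * I * s * z y)) (Ioi y₀) := by
  obtain ⟨b, hb, hle⟩ := H.exists_integrable_bound |s.im|
  exact Integrable.mono' hb (H.aestronglyMeasurable_integrand s)
    ((ae_restrict_iff' measurableSet_Ioi).mpr (ae_of_all _ fun y hy => hle y hy s hs le_rfl))

theorem hasDerivAt (H : IsGaussianWeight y₀ z h) {s : ℂ} (hs : -(1 / 4) < s.re) :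
    HasDerivAt (gaussianSuperposition y₀ z h)
      (Real.pi * I * gaussianSuperposition y₀ z (fun y => h y * z y) s) s := by
  obtain ⟨b, hb, hle⟩ := H.mul_curve.exists_integrable_bound (|s.im| + 1)
  have hU : {w : ℂ | -(1 / 4) < w.re ∧ |w.im| < |s.im| + 1} ∈ 𝓝 s := by
    refine IsOpen.mem_nhds ?_ ⟨hs, by linarith⟩
    exact (isOpen_lt continuous_const continuous_re).inter
      (isOpen_lt continuous_im.abs continuous_const)
  have key := (hasDerivAt_integral_of_dominated_loc_of_deriv_le
    (μ := volume.restrict (Ioi y₀)) (F := fun w y => h y * exp (Real.pi * I * w * z y))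
    (F' := fun w y => Real.pi * I * (h y * z y * exp (Real.pi * I * w * z y)))
    (bound := fun y => Real.pi * b y) hU
    (Eventually.of_forall H.aestronglyMeasurable_integrand) (H.integrableOn_integrand hs)
    ((H.mul_curve.aestronglyMeasurable_integrand s).const_mul _)
    ((ae_restrict_iff' measurableSet_Ioi).mpr (ae_of_all _ fun y hy w hw => ?_))
    (hb.const_mul _) (ae_of_all _ fun y w _ => ?_)).2
  · rw [integral_const_mul] at key
    exact key
  · rw [norm_mul, norm_mul, norm_I, mul_one, norm_real, Real.norm_of_nonneg Real.pi_pos.le]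
    exact mul_le_mul_of_nonneg_left (hle y hy w hw.1 hw.2.le) Real.pi_pos.le
  · have h1 : HasDerivAt (fun w : ℂ => Real.pi * I * w * z y) (Real.pi * I * z y) w := by
      simpa using ((hasDerivAt_id w).const_mul (Real.pi * I : ℂ)).mul_const (z y)
    exact (h1.cexp.const_mul (h y)).congr_deriv (by ring)

theorem analyticOnNhd (H : IsGaussianWeight y₀ z h) :
    AnalyticOnNhd ℝ (fun s : ℝ => gaussianSuperposition y₀ z h s) (Ioi (-(1 / 4))) := by
  have hopen : IsOpen {w : ℂ | -(1 / 4) < w.re} := isOpen_lt continuous_const continuous_re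
  have hd : DifferentiableOn ℂ (gaussianSuperposition y₀ z h) {w : ℂ | -(1 / 4) < w.re} :=
    fun s hs => (H.hasDerivAt hs).differentiableAt.differentiableWithinAt
  intro s hs
  have h1 : AnalyticAt ℝ (gaussianSuperposition y₀ z h) (s : ℂ) :=
    (hd.analyticOnNhd hopen (s : ℂ) (by simpa using hs)).restrictScalars
  exact h1.comp (ofRealCLM.analyticAt s)

theorem iteratedDeriv_eq (H : IsGaussianWeight y₀ z h) (n : ℕ) :
    ∀ s : ℝ, -(1 / 4) < s → iteratedDeriv n (fun s : ℝ => gaussianSuperposition y₀ z h s) s =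
      (Real.pi * I) ^ n * gaussianSuperposition y₀ z (fun y => h y * z y ^ n) s := by
  induction n with
  | zero => intro s _; simp
  | succ n ih =>
    intro s hs
    have hd := ((H.mul_curve_pow n).hasDerivAt (s := (s : ℂ)) (by simpa using hs)).comp_ofReal
    rw [iteratedDeriv_succ]
    have he : iteratedDeriv n (fun s : ℝ => gaussianSuperposition y₀ z h s) =ᶠ[𝓝 s]
        fun s : ℝ => (Real.pi * I) ^ n * gaussianSuperposition y₀ z (fun y => h y * z y ^ n) s := by
      filter_upwards [Ioi_mem_nhds hs] with t ht using ih t ht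
    rw [he.deriv_eq, (hd.const_mul _).deriv]
    simp only [pow_succ, mul_assoc]

/-- Since `Im z ≥ 1/(2y)`, the Gaussian is at most `e^{-πs/(2y)}`. Multiplied by `s^N` this is at
most `N! (2y)^N`, a polynomial loss that the weight absorbs. -/
theorem exists_pow_mul_norm_le (H : IsGaussianWeight y₀ z h) (N : ℕ) :
    ∃ C : ℝ, ∀ s : ℝ, 0 ≤ s → s ^ N * ‖gaussianSuperposition y₀ z h s‖ ≤ C := by
  obtain ⟨C, k, hC, hb⟩ := H.norm_weight_le
  refine ⟨∫ y in Ioi y₀, C * N.factorial * 2 ^ N * (k + N).factorial * Real.exp (-(1 / 2) * y),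
    fun s hs => ?_⟩
  have e : s ^ N * ‖gaussianSuperposition y₀ z h s‖ =
      ‖∫ y in Ioi y₀, (s : ℂ) ^ N * (h y * exp (Real.pi * I * s * z y))‖ := by
    rw [integral_const_mul, norm_mul, norm_pow, norm_real, Real.norm_of_nonneg hs]
    rfl
  rw [e]
  refine norm_integral_le_of_norm_le ((integrableOn_exp_neg_half y₀).const_mul _)
    ((ae_restrict_iff' measurableSet_Ioi).mpr (ae_of_all _ fun y hy => ?_))
  have hy0 := H.pos hy
  have hpi := Real.pi_gt_three
  have hx : 0 ≤ Real.pi * s / (2 * y) := by positivity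
  have h1 : s ^ N * Real.exp (-(Real.pi * s / (2 * y))) ≤ N.factorial * 2 ^ N * y ^ N := by
    have := Real.pow_div_factorial_le_exp _ hx N
    rw [div_le_iff₀ (by positivity)] at this
    have hsx : s ≤ 2 * y * (Real.pi * s / (2 * y)) := by
      have : 2 * y * (Real.pi * s / (2 * y)) = Real.pi * s := by field_simp
      rw [this]
      nlinarith
    calc _ ≤ (2 * y * (Real.pi * s / (2 * y))) ^ N * Real.exp (-(Real.pi * s / (2 * y))) := by
          gcongr
      _ = (2 * y) ^ N * (Real.pi * s / (2 * y)) ^ N * Real.exp (-(Real.pi * s / (2 * y))) := by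
          rw [mul_pow]
      _ ≤ (2 * y) ^ N * (Real.exp (Real.pi * s / (2 * y)) * N.factorial) *
          Real.exp (-(Real.pi * s / (2 * y))) := by gcongr
      _ = (2 * y) ^ N * N.factorial *
          (Real.exp (Real.pi * s / (2 * y)) * Real.exp (-(Real.pi * s / (2 * y)))) := by ring
      _ = _ := by rw [← Real.exp_add, add_neg_cancel, Real.exp_zero, mul_pow]; ring
  have h2 : ‖exp (Real.pi * I * s * z y)‖ ≤ Real.exp (-(Real.pi * s / (2 * y))) := by
    rw [norm_exp_pi_mul_I_mul, Real.exp_le_exp]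
    simp only [ofReal_re, ofReal_im, zero_mul, add_zero]
    have := mul_le_mul_of_nonneg_left (H.le_im y hy) (by positivity : 0 ≤ Real.pi * s)
    have e : Real.pi * s * (1 / (2 * y)) = Real.pi * s / (2 * y) := by ring
    linarith
  have h3 : Real.exp (-Real.pi * y) * y ^ (k + N) ≤
      (k + N).factorial * Real.exp (-(1 / 2) * y) := by
    refine le_trans ?_ (pow_mul_exp_le (k + N) hy0.le)
    rw [mul_comm]
    exact le_mul_of_one_le_right (by positivity) (Real.one_le_exp (by positivity))
  rw [norm_mul, norm_mul, norm_pow, norm_real, Real.norm_of_nonneg hs]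
  calc _ ≤ s ^ N * (C * y ^ k * Real.exp (-Real.pi * y) *
        Real.exp (-(Real.pi * s / (2 * y)))) := by gcongr; exact hb y hy
    _ = C * y ^ k * Real.exp (-Real.pi * y) *
        (s ^ N * Real.exp (-(Real.pi * s / (2 * y)))) := by ring
    _ ≤ C * y ^ k * Real.exp (-Real.pi * y) * (N.factorial * 2 ^ N * y ^ N) := by gcongr
    _ = C * N.factorial * 2 ^ N * (Real.exp (-Real.pi * y) * y ^ (k + N)) := by
        rw [pow_add]; ring
    _ ≤ C * N.factorial * 2 ^ N * ((k + N).factorial * Real.exp (-(1 / 2) * y)) := by gcongr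
    _ = _ := by ring

end IsGaussianWeight

/-! ### Radial Schwartz functions -/

theorem exists_schwartzMap_eqOn_Ici {F : ℝ → ℂ} (hF : ContDiffOn ℝ (⊤ : ℕ∞) F (Ioi (-(1 / 4))))
    (hdecay : ∀ k n : ℕ, ∃ C : ℝ, ∀ s : ℝ, 0 ≤ s → s ^ k * ‖iteratedDeriv n F s‖ ≤ C) :
    ∃ g : 𝓢(ℝ, ℂ), ∀ s : ℝ, 0 ≤ s → g s = F s := by
  -- The cutoff vanishes for `s ≤ -3/16` and is `1` for `s ≥ -1/8`, so its transition lies inside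
  -- `(-1/4, 0)`, where `F` is smooth.
  set χ : ℝ → ℝ := fun s => Real.smoothTransition (16 * s + 3) with hχ
  have hχd : ContDiff ℝ (⊤ : ℕ∞) χ := Real.smoothTransition.contDiff.comp (by fun_prop)
  set G : ℝ → ℂ := fun s => χ s • F s with hG
  have hG0 : ∀ s < -(3 / 16 : ℝ), G =ᶠ[𝓝 s] 0 := fun s hs => by
    filter_upwards [Iio_mem_nhds hs] with t ht
    have : 16 * t + 3 ≤ 0 := by rw [mem_Iio] at ht; linarith
    simp [hG, hχ, Real.smoothTransition.zero_of_nonpos this]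
  have hG1 : ∀ s > -(1 / 8 : ℝ), G =ᶠ[𝓝 s] F := fun s hs => by
    filter_upwards [Ioi_mem_nhds hs] with t ht
    have : 1 ≤ 16 * t + 3 := by rw [mem_Ioi] at ht; linarith
    simp [hG, hχ, Real.smoothTransition.one_of_one_le this]
  have hGd : ContDiff ℝ (⊤ : ℕ∞) G := by
    rw [contDiff_iff_contDiffAt]
    intro s
    rcases lt_or_ge (-(1 / 4)) s with hs | hs
    · exact hχd.contDiffAt.smul (hF.contDiffAt (Ioi_mem_nhds hs))
    · exact contDiffAt_const.congr_of_eventuallyEq (hG0 s (by linarith))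
  refine ⟨⟨G, hGd, fun k n => ?_⟩, fun s hs => (hG1 s (by linarith)).self_of_nhds⟩
  obtain ⟨C, hC⟩ := hdecay k n
  have hcont : Continuous fun s : ℝ => ‖s‖ ^ k * ‖iteratedFDeriv ℝ n G s‖ :=
    (continuous_norm.pow k).mul (hGd.continuous_iteratedFDeriv (by exact_mod_cast le_top)).norm
  obtain ⟨B, hB⟩ := (isCompact_Icc (a := (-1 : ℝ)) (b := 0)).exists_bound_of_continuousOn
    hcont.continuousOn
  refine ⟨max (max B C) 0, fun s => ?_⟩
  rcases lt_or_ge s (-1) with h1 | h1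
  · have : iteratedFDeriv ℝ n G s = 0 := by
      rw [((hG0 s (by linarith)).iteratedFDeriv ℝ n).self_of_nhds]
      simp
    rw [this]
    simp
  rcases le_or_gt s 0 with h2 | h2
  · exact (le_abs_self _).trans ((hB s ⟨h1, h2⟩).trans ((le_max_left _ _).trans (le_max_left _ _)))
  · rw [((hG1 s (by linarith)).iteratedFDeriv ℝ n).self_of_nhds,
      norm_iteratedFDeriv_eq_norm_iteratedDeriv, Real.norm_of_nonneg h2.le]
    exact (hC s h2.le).trans ((le_max_right _ _).trans (le_max_left _ _))

theorem exists_schwartzMap_comp_norm_sq {E : Type*} [NormedAddCommGroup E] [InnerProductSpace ℝ E]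
    (g : 𝓢(ℝ, ℂ)) : ∃ f : 𝓢(E, ℂ), ∀ x, f x = g (‖x‖ ^ 2) := by
  -- The growth condition needed for composition is `‖x‖ ≤ 1 · (1 + ‖x‖²)¹`.
  refine ⟨SchwartzMap.compCLM ℝ (Function.hasTemperateGrowth_norm_sq E) ⟨1, 1, fun x => ?_⟩ g,
    fun x => rfl⟩
  rw [norm_pow, norm_norm]
  nlinarith [sq_nonneg (‖x‖ - 1)]

theorem IsGaussianWeight.exists_schwartzMap {y₀ : ℝ} {z h : ℝ → ℂ} (H : IsGaussianWeight y₀ z h)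
    (E : Type*) [NormedAddCommGroup E] [InnerProductSpace ℝ E] :
    ∃ f : 𝓢(E, ℂ), ∀ x, f x = gaussianSuperposition y₀ z h ((‖x‖ ^ 2 : ℝ) : ℂ) := by
  obtain ⟨g, hg⟩ := exists_schwartzMap_eqOn_Ici
    (F := fun s : ℝ => gaussianSuperposition y₀ z h s)
    (H.analyticOnNhd.contDiffOn (uniqueDiffOn_Ioi _)) fun k n => by
      obtain ⟨C, hC⟩ := (H.mul_curve_pow n).exists_pow_mul_norm_le k
      refine ⟨‖(Real.pi * I : ℂ) ^ n‖ * C, fun s hs => ?_⟩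
      rw [H.iteratedDeriv_eq n s (by linarith), norm_mul, mul_left_comm]
      exact mul_le_mul_of_nonneg_left (hC s hs) (norm_nonneg _)
  obtain ⟨f, hf⟩ := exists_schwartzMap_comp_norm_sq (E := E) g
  exact ⟨f, fun x => by rw [hf, hg _ (by positivity)]⟩

/-! ### Fourier transform of a superposition of Gaussians -/

/-- In dimension 4 the Gaussian factor is `(π/b)²` with `b = -πiz`, that is `(i/z)² = -1/z²`, with
no branch to choose. -/
theorem fourier_exp_norm_sq_four {z : ℂ} (hz : 0 < z.im) (ξ : EuclideanSpace ℝ (Fin 4)) :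
    𝓕 (fun x : EuclideanSpace ℝ (Fin 4) => exp (Real.pi * I * ((‖x‖ ^ 2 : ℝ) : ℂ) * z)) ξ =
      -1 / z ^ 2 * exp (Real.pi * I * ((‖ξ‖ ^ 2 : ℝ) : ℂ) * (-1 / z)) := by
  have hz0 : z ≠ 0 := fun h => by simp [h] at hz
  have hpi : (Real.pi : ℂ) ≠ 0 := ofReal_ne_zero.mpr Real.pi_ne_zero
  have hb : 0 < (-(Real.pi * I * z)).re := by
    simp only [neg_re, mul_re, ofReal_re, I_re, mul_zero, ofReal_im, I_im, mul_one,
      zero_mul, mul_im, add_zero, zero_sub, neg_neg, sub_self]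
    positivity
  have h := fourier_gaussian_innerProductSpace hb ξ
  have e1 : (fun x : EuclideanSpace ℝ (Fin 4) => exp (Real.pi * I * ((‖x‖ ^ 2 : ℝ) : ℂ) * z)) =
      fun x => exp (-(-(Real.pi * I * z)) * (‖x‖ : ℂ) ^ 2) := by
    ext x
    push_cast
    ring_nf
  have e2 : ((Module.finrank ℝ (EuclideanSpace ℝ (Fin 4)) : ℂ) / 2) = ((2 : ℕ) : ℂ) := by
    rw [finrank_euclideanSpace_fin]
    norm_num
  rw [e1, h, e2, cpow_natCast]
  congr 1
  · field_simp
    rw [I_sq]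
    ring
  · congr 1
    push_cast
    field_simp
    rw [I_sq]
    ring

theorem integrable_exp_norm_sq {V : Type*} [NormedAddCommGroup V] [InnerProductSpace ℝ V]
    [FiniteDimensional ℝ V] [MeasurableSpace V] [BorelSpace V] {b : ℝ} (hb : 0 < b) :
    Integrable fun x : V => Real.exp (-b * ‖x‖ ^ 2) := by
  have := GaussianFourier.integrable_cexp_neg_mul_sq_norm_add (V := V) (b := b) (by simpa) 0 0
  refine this.norm.congr (ae_of_all _ fun x => ?_)
  simp only [zero_mul, add_zero, Complex.norm_exp]
  norm_cast

theorem integral_exp_norm_sq_four {b : ℝ} (hb : 0 < b) :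
    ∫ x : EuclideanSpace ℝ (Fin 4), Real.exp (-(Real.pi * b) * ‖x‖ ^ 2) = 1 / b ^ 2 := by
  rw [GaussianFourier.integral_rexp_neg_mul_sq_norm (by positivity), finrank_euclideanSpace_fin]
  have : (((4 : ℕ) : ℝ) / 2) = ((2 : ℕ) : ℝ) := by norm_num
  rw [this, Real.rpow_natCast]
  have := Real.pi_ne_zero
  field_simp

namespace IsGaussianWeight

variable {y₀ : ℝ} {z h : ℝ → ℂ}

/-- The Gaussian with parameter `z` has `L¹` norm `1/(Im z)²` on `ℝ⁴`, so this is the absolute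
integrability needed for Fubini in `fourier_eq`. -/
theorem integrableOn_norm_div_im_sq (H : IsGaussianWeight y₀ z h) :
    IntegrableOn (fun y => ‖h y‖ * (1 / (z y).im ^ 2)) (Ioi y₀) := by
  obtain ⟨C, k, hC, hb⟩ := H.norm_weight_le
  refine Integrable.mono' ((integrableOn_exp_neg_half y₀).const_mul
    (4 * C * (k + 2).factorial)) ?_ ((ae_restrict_iff' measurableSet_Ioi).mpr
      (ae_of_all _ fun y hy => ?_))
  · refine ContinuousOn.aestronglyMeasurable ?_ measurableSet_Ioi
    refine H.continuousOn_weight.norm.mul (continuousOn_const.div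
      ((continuous_im.comp_continuousOn H.continuousOn_curve).pow 2) fun y hy => ?_)
    exact pow_ne_zero _ (H.im_pos hy).ne'
  · have hy0 := H.pos hy
    have him := H.im_pos hy
    have h1 : 1 / (z y).im ^ 2 ≤ 4 * y ^ 2 := by
      have := H.le_im y hy
      rw [div_le_iff₀ (by positivity)] at this
      rw [div_le_iff₀ (by positivity)]
      nlinarith
    rw [Real.norm_of_nonneg (by positivity)]
    calc _ ≤ C * y ^ k * Real.exp (-Real.pi * y) * (4 * y ^ 2) := by
          gcongr
          exact hb y hy
      _ = 4 * C * (y ^ (k + 2) * Real.exp (-Real.pi * y) * 1) := by ring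
      _ ≤ 4 * C * (y ^ (k + 2) * Real.exp (-Real.pi * y) * Real.exp (Real.pi * y / 2)) := by
          gcongr
          exact Real.one_le_exp (by have := Real.pi_pos; positivity)
      _ ≤ 4 * C * ((k + 2).factorial * Real.exp (-(1 / 2) * y)) :=
          mul_le_mul_of_nonneg_left (pow_mul_exp_le _ hy0.le) (by positivity)
      _ = _ := by ring

theorem fourier_eq (H : IsGaussianWeight y₀ z h) (ξ : EuclideanSpace ℝ (Fin 4)) :
    𝓕 (fun x : EuclideanSpace ℝ (Fin 4) =>
        gaussianSuperposition y₀ z h ((‖x‖ ^ 2 : ℝ) : ℂ)) ξ =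
      gaussianSuperposition y₀ (fun y => -1 / z y) (fun y => -h y / z y ^ 2)
        ((‖ξ‖ ^ 2 : ℝ) : ℂ) := by
  set f : EuclideanSpace ℝ (Fin 4) → ℝ → ℂ := fun x y =>
    exp ((-2 * Real.pi * inner ℝ x ξ : ℝ) * I) *
      (h y * exp (Real.pi * I * ((‖x‖ ^ 2 : ℝ) : ℂ) * z y)) with hf
  have hnorm : ∀ x y, ‖f x y‖ = ‖h y‖ * Real.exp (-(Real.pi * (z y).im) * ‖x‖ ^ 2) := by
    intro x y
    rw [hf]
    simp only
    rw [norm_mul, norm_exp_ofReal_mul_I, one_mul, norm_mul, norm_exp_pi_mul_I_mul]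
    congr 2
    simp only [ofReal_re, ofReal_im]
    ring
  have hmeas : AEStronglyMeasurable (Function.uncurry f)
      (volume.prod (volume.restrict (Ioi y₀))) := by
    have hz : AEStronglyMeasurable z (volume.restrict (Ioi y₀)) :=
      H.continuousOn_curve.aestronglyMeasurable measurableSet_Ioi
    have hh : AEStronglyMeasurable h (volume.restrict (Ioi y₀)) :=
      H.continuousOn_weight.aestronglyMeasurable measurableSet_Ioi
    refine AEStronglyMeasurable.mul
      (Continuous.aestronglyMeasurable (by fun_prop)) (hh.comp_snd.mul ?_)
    refine continuous_exp.comp_aestronglyMeasurable (AEStronglyMeasurable.mul ?_ hz.comp_snd)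
    exact Continuous.aestronglyMeasurable (by fun_prop)
  have hint : Integrable (Function.uncurry f) (volume.prod (volume.restrict (Ioi y₀))) := by
    rw [integrable_prod_iff' hmeas]
    constructor
    · refine (ae_restrict_iff' measurableSet_Ioi).mpr (ae_of_all _ fun y hy => ?_)
      have hb : 0 < Real.pi * (z y).im := mul_pos Real.pi_pos (H.im_pos hy)
      refine Integrable.mono' ((integrable_exp_norm_sq hb).const_mul ‖h y‖)
        (Continuous.aestronglyMeasurable (by simp only [hf, Function.uncurry]; fun_prop))
        (ae_of_all _ fun x => ?_)
      exact (hnorm x y).le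
    · refine H.integrableOn_norm_div_im_sq.congr
        ((ae_restrict_iff' measurableSet_Ioi).mpr (ae_of_all _ fun y hy => ?_))
      simp only [Function.uncurry, hnorm]
      rw [integral_const_mul, integral_exp_norm_sq_four (H.im_pos hy)]
  rw [Real.fourier_eq', gaussianSuperposition]
  calc _ = ∫ x, ∫ y in Ioi y₀, f x y := by
        refine integral_congr_ae (ae_of_all _ fun x => ?_)
        simp only [hf, smul_eq_mul, gaussianSuperposition]
        rw [integral_const_mul]
    _ = ∫ y in Ioi y₀, ∫ x, f x y := integral_integral_swap hint
    _ = _ := by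
        refine setIntegral_congr_fun measurableSet_Ioi fun y hy => ?_
        have h1 := fourier_exp_norm_sq_four (H.im_pos hy) ξ
        rw [Real.fourier_eq'] at h1
        simp only [smul_eq_mul] at h1
        simp only [hf, mul_left_comm _ (h y)]
        rw [integral_const_mul, h1]
        ring

end IsGaussianWeight

/-! ### The four pieces of the eigenfunction -/

/-- The unit circle arc from `ε` to `i`, where `ε = ±1`, parametrised by the vertical
half-line `ε/2 + iy`, `y ≥ 1/2`, through `w ↦ ε - 1/w`. -/
def arcCurve (ε y : ℝ) : ℂ := ε - 1 / (ε / 2 + I * y)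

/-- The weight of `φ(z + 1) dz` in the parametrisation `arcCurve`. -/
def arcWeight (ε y : ℝ) : ℂ := -I * psi (ε / 2 + I * y) / (ε / 2 + I * y) ^ 2

/-- The segment from `0` to `i`, parametrised by `y ≥ 1` through `i / y`. -/
def segmentCurve (y : ℝ) : ℂ := -1 / (I * y)

/-- The weight of `-2 φ(z) dz` in the parametrisation `segmentCurve`. -/
def segmentWeight (y : ℝ) : ℂ := 2 * I * psi (I * y) / (I * y) ^ 2

/-- The vertical half-line from `i` to `i∞`. -/
def rayCurve (y : ℝ) : ℂ := I * y

/-- The weight of `-2 ψ(z) dz` in the parametrisation `rayCurve`. -/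
def rayWeight (y : ℝ) : ℂ := -2 * I * psi (I * y)

/-- The contour integral that continues `-4 i sin²(π s / 2) ∫₀^∞ φ(it) e^{-π s t} dt` to small
values of `s`. -/
def eigenProfile (s : ℂ) : ℂ :=
  gaussianSuperposition (1 / 2) (arcCurve (-1)) (arcWeight (-1)) s +
    gaussianSuperposition (1 / 2) (arcCurve 1) (arcWeight 1) s +
    gaussianSuperposition 1 segmentCurve segmentWeight s +
    gaussianSuperposition 1 rayCurve rayWeight s

theorem continuousOn_psi_vertical (x y₀ : ℝ) (hy₀ : 0 ≤ y₀) :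
    ContinuousOn (fun y : ℝ => psi (x + I * y)) (Ioi y₀) := by
  intro y hy
  have hy : 0 < ((x : ℂ) + I * y).im := by simpa using hy₀.trans_lt hy
  exact (ContinuousAt.comp (f := fun y : ℝ => (x : ℂ) + I * y) (differentiableAt_psi hy).continuousAt
    (by fun_prop)).continuousWithinAt

theorem vertical_ne_zero (x : ℝ) {y : ℝ} (hy : 0 < y) : (x : ℂ) + I * y ≠ 0 := fun h => by
  have := congrArg Complex.im h
  simp at this
  exact hy.ne' this

theorem sq_le_norm_vertical_sq (x y : ℝ) : y ^ 2 ≤ ‖(x : ℂ) + I * y‖ ^ 2 := by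
  rw [← normSq_eq_norm_sq, normSq_apply]
  simp
  nlinarith [sq_nonneg x]

theorem exists_norm_psi_vertical_le :
    ∃ C : ℝ, 0 < C ∧ ∀ x y : ℝ, |x| ≤ 1 → 1 / 2 ≤ y →
      ‖psi (x + I * y)‖ ≤ C * Real.exp (-Real.pi * y) := by
  obtain ⟨C, hC, h⟩ := exists_norm_phi_psi_le
  refine ⟨C, hC, fun x y hx hy => ?_⟩
  simpa using (h (x + I * y) (by simpa using hx) (by simpa using hy)).2

theorem norm_div_vertical_sq_le {C x y : ℝ} {b : ℂ} (hy : 1 / 2 ≤ y) (hC : 0 ≤ C)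
    (hb : ‖b‖ ≤ C) : ‖b / (x + I * y) ^ 2‖ ≤ 4 * C := by
  have h := sq_le_norm_vertical_sq x y
  have h' : (1 / 4 : ℝ) ≤ ‖(x : ℂ) + I * y‖ ^ 2 := by nlinarith
  rw [norm_div, norm_pow, div_le_iff₀ (by linarith)]
  nlinarith

theorem arcCurve_eq {ε : ℝ} (hε : ε ^ 2 = 1) (y : ℝ) :
    arcCurve ε y = ⟨ε - ε / 2 / (1 / 4 + y ^ 2), y / (1 / 4 + y ^ 2)⟩ := by
  have h4 : (ε / 2) * (ε / 2) + y * y = 1 / 4 + y ^ 2 := by nlinarith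
  apply Complex.ext <;> simp [arcCurve, normSq_apply, Complex.inv_re, Complex.inv_im,
    h4]
  · ring

theorem isGaussianWeight_arc {ε : ℝ} (hε : ε ^ 2 = 1) :
    IsGaussianWeight (1 / 2) (arcCurve ε) (arcWeight ε) := by
  obtain ⟨C, hC, hb⟩ := exists_norm_psi_vertical_le
  have hε1 : |ε / 2| ≤ 1 := by rw [abs_le]; constructor <;> nlinarith
  have hpos : ∀ y ∈ Ioi (1 / 2 : ℝ), 0 < y := fun y hy => by rw [mem_Ioi] at hy; linarith
  have hne : ∀ y ∈ Ioi (1 / 2 : ℝ), (ε : ℂ) / 2 + I * y ≠ 0 := fun y hy => by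
    have := vertical_ne_zero (ε / 2) (hpos y hy)
    push_cast at this
    exact this
  have hnorm : ∀ y ∈ Ioi (1 / 2 : ℝ), ‖arcCurve ε y‖ = 1 := fun y hy => by
    have h0 := hpos y hy
    rw [← sq_eq_sq₀ (norm_nonneg _) zero_le_one, ← normSq_eq_norm_sq, arcCurve_eq hε y,
      normSq_apply]
    have h4 : (1 / 4 + y ^ 2 : ℝ) ≠ 0 := by positivity
    field_simp
    have : ε ^ 2 * (1 + 4 * y ^ 2 - 2) ^ 2 = (1 + 4 * y ^ 2 - 2) ^ 2 := by rw [hε, one_mul]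
    nlinarith
  refine ⟨le_rfl, ?_, ?_, fun y hy => ?_, fun y hy => ?_, fun y hy => ?_,
    4 * C, 0, by positivity, fun y hy => ?_⟩
  · exact continuousOn_const.sub (continuousOn_const.div (by fun_prop) hne)
  · have := continuousOn_psi_vertical (ε / 2) (1 / 2) (by norm_num)
    push_cast at this
    exact (continuousOn_const.mul this).div (by fun_prop) fun y hy => pow_ne_zero _ (hne y hy)
  · have h0 := hpos y hy
    rw [mem_Ioi] at hy
    rw [arcCurve_eq hε y]
    simp only
    rw [div_le_div_iff₀ (by positivity) (by positivity)]
    nlinarith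
  · rw [hnorm y hy]
    rw [mem_Ioi] at hy
    linarith
  · exact (abs_re_le_norm _).trans (hnorm y hy).le
  · rw [mem_Ioi] at hy
    have h1 := hb (ε / 2) y hε1 hy.le
    have h2 := norm_div_vertical_sq_le (x := ε / 2) (b := -I * psi ((ε / 2 : ℝ) + I * y))
      (C := C * Real.exp (-Real.pi * y)) hy.le
      (by positivity) (by simpa using h1)
    push_cast at h2
    rw [arcWeight]
    linarith

theorem isGaussianWeight_ray : IsGaussianWeight 1 rayCurve rayWeight := by
  obtain ⟨C, hC, hb⟩ := exists_norm_psi_vertical_le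
  refine ⟨by norm_num, ?_, ?_, fun y hy => ?_, fun y hy => ?_, fun y hy => ?_,
    2 * C, 0, by positivity, fun y hy => ?_⟩
  · unfold rayCurve; fun_prop
  · have := continuousOn_psi_vertical 0 1 (by norm_num)
    simp only [ofReal_zero, zero_add] at this
    exact continuousOn_const.mul this
  · rw [mem_Ioi] at hy
    rw [div_le_iff₀ (by linarith)]
    simp [rayCurve]
    nlinarith
  · rw [mem_Ioi] at hy
    simp [rayCurve, abs_of_pos (zero_lt_one.trans hy)]
    linarith
  · simp [rayCurve]
  · rw [mem_Ioi] at hy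
    have h1 := hb 0 y (by simp) (by linarith)
    simp only [ofReal_zero, zero_add] at h1
    simp only [rayWeight, norm_mul, norm_neg, norm_I, Complex.norm_ofNat, pow_zero]
    linarith

theorem segmentCurve_eq {y : ℝ} (hy : 0 < y) : segmentCurve y = ((1 / y : ℝ) : ℂ) * I := by
  have : (y : ℂ) ≠ 0 := ofReal_ne_zero.mpr hy.ne'
  rw [segmentCurve]
  push_cast
  field_simp
  rw [I_sq]

theorem isGaussianWeight_segment : IsGaussianWeight 1 segmentCurve segmentWeight := by
  obtain ⟨C, hC, hb⟩ := exists_norm_psi_vertical_le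
  have hpos : ∀ y ∈ Ioi (1 : ℝ), 0 < y := fun y hy => by rw [mem_Ioi] at hy; linarith
  have hne : ∀ y ∈ Ioi (1 : ℝ), I * (y : ℂ) ≠ 0 := fun y hy =>
    mul_ne_zero I_ne_zero (ofReal_ne_zero.mpr (hpos y hy).ne')
  refine ⟨by norm_num, ?_, ?_, fun y hy => ?_, fun y hy => ?_, fun y hy => ?_,
    8 * C, 0, by positivity, fun y hy => ?_⟩
  · exact continuousOn_const.div (by fun_prop) hne
  · have := continuousOn_psi_vertical 0 1 (by norm_num)
    simp only [ofReal_zero, zero_add] at this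
    exact (continuousOn_const.mul this).div (by fun_prop) fun y hy => pow_ne_zero _ (hne y hy)
  · have h0 := hpos y hy
    rw [segmentCurve_eq h0, im_ofReal_mul, I_im, mul_one]
    exact one_div_le_one_div_of_le h0 (by linarith)
  · have h0 := hpos y hy
    rw [mem_Ioi] at hy
    rw [segmentCurve_eq h0, norm_mul, norm_I, mul_one, norm_real, Real.norm_of_nonneg (by positivity),
      div_le_iff₀ h0]
    nlinarith
  · rw [segmentCurve_eq (hpos y hy)]
    simp
  · rw [mem_Ioi] at hy
    have h1 := hb 0 y (by simp) (by linarith)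
    have h2 := norm_div_vertical_sq_le (x := 0) (y := y) (C := 2 * (C * Real.exp (-Real.pi * y)))
      (b := 2 * I * psi ((0 : ℝ) + I * y)) (by linarith) (by positivity) (by
        simpa only [norm_mul, norm_I, Complex.norm_ofNat, mul_one] using
          mul_le_mul_of_nonneg_left h1 zero_le_two)
    simp only [ofReal_zero, zero_add] at h2
    rw [segmentWeight]
    linarith

/-! ### The Fourier transform exchanges the pieces -/

theorem gaussianSuperposition_congr {y₀ : ℝ} {z h z' h' : ℝ → ℂ} (hz : EqOn z z' (Ioi y₀))
    (hh : EqOn h h' (Ioi y₀)) (s : ℂ) :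
    gaussianSuperposition y₀ z h s = gaussianSuperposition y₀ z' h' s :=
  setIntegral_congr_fun measurableSet_Ioi fun y hy => by simp only [hz hy, hh hy]

/-- On the unit circle `-1/z = -z̄`, which reflects one arc onto the other with the same parameter
`y`. The minus sign in `-h/z²` is compensated by `ψ(w+1) = -ψ(w)`. -/
theorem fourier_arc {ε : ℝ} (hε : ε = 1 ∨ ε = -1) (ξ : EuclideanSpace ℝ (Fin 4)) :
    𝓕 (fun x : EuclideanSpace ℝ (Fin 4) =>
        gaussianSuperposition (1 / 2) (arcCurve ε) (arcWeight ε) ((‖x‖ ^ 2 : ℝ) : ℂ)) ξ =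
      gaussianSuperposition (1 / 2) (arcCurve (-ε)) (arcWeight (-ε)) ((‖ξ‖ ^ 2 : ℝ) : ℂ) := by
  have hε2 : ε ^ 2 = 1 := by rcases hε with rfl | rfl <;> norm_num
  have hε2' : (ε : ℂ) ^ 2 = 1 := by exact_mod_cast hε2
  rw [(isGaussianWeight_arc hε2).fourier_eq]
  have key : ∀ y ∈ Ioi (1 / 2 : ℝ), (ε : ℂ) / 2 + I * y ≠ 0 ∧ ((-ε : ℝ) : ℂ) / 2 + I * y ≠ 0 ∧
      (ε : ℂ) ≠ 0 ∧
      arcCurve ε y = ε * (((-ε : ℝ) : ℂ) / 2 + I * y) / ((ε : ℂ) / 2 + I * y) := by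
    intro y hy
    have hy : 0 < y := by rw [mem_Ioi] at hy; linarith
    have h1 := vertical_ne_zero (ε / 2) hy
    have h2 := vertical_ne_zero (-ε / 2) hy
    push_cast at h1 h2 ⊢
    refine ⟨h1, h2, fun h => by simp [h] at hε2', ?_⟩
    rw [arcCurve, eq_div_iff h1, sub_mul, one_div, inv_mul_cancel₀ h1]
    linear_combination hε2'
  refine gaussianSuperposition_congr (fun y hy => ?_) (fun y hy => ?_) _
  · obtain ⟨h1, h2, h3, h4⟩ := key y hy
    rw [h4, arcCurve]
    generalize hw : ((-ε : ℝ) : ℂ) / 2 + I * y = w at *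
    have hw' : (ε : ℂ) / 2 + I * y = w + ε := by rw [← hw]; push_cast; ring
    rw [hw'] at h1 ⊢
    push_cast
    field_simp
    linear_combination w * hε2'
  · obtain ⟨h1, h2, h3, h4⟩ := key y hy
    have hy : 0 < y := by rw [mem_Ioi] at hy; linarith
    have hψ : psi ((ε : ℂ) / 2 + I * y) = -psi (((-ε : ℝ) : ℂ) / 2 + I * y) := by
      rcases hε with rfl | rfl
      · rw [← psi_add_one (by simpa using hy)]
        congr 1
        push_cast
        ring
      · rw [eq_neg_iff_add_eq_zero, add_comm, ← eq_neg_iff_add_eq_zero,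
          ← psi_add_one (by simpa using hy)]
        congr 1
        push_cast
        ring
    simp only [arcWeight]
    rw [h4, hψ]
    generalize ((-ε : ℝ) : ℂ) / 2 + I * y = w at *
    generalize (ε : ℂ) / 2 + I * y = w' at *
    field_simp
    rw [hε2', mul_one]

theorem fourier_segment (ξ : EuclideanSpace ℝ (Fin 4)) :
    𝓕 (fun x : EuclideanSpace ℝ (Fin 4) =>
        gaussianSuperposition 1 segmentCurve segmentWeight ((‖x‖ ^ 2 : ℝ) : ℂ)) ξ =
      gaussianSuperposition 1 rayCurve rayWeight ((‖ξ‖ ^ 2 : ℝ) : ℂ) := by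
  rw [isGaussianWeight_segment.fourier_eq]
  refine gaussianSuperposition_congr (fun _ _ => neg_one_div_neg_one_div _) (fun y hy => ?_) _
  have hy : (y : ℂ) ≠ 0 := by
    rw [mem_Ioi] at hy
    exact ofReal_ne_zero.mpr (by linarith)
  have hI := I_ne_zero
  simp only [segmentWeight, rayWeight, segmentCurve]
  field_simp

theorem fourier_ray (ξ : EuclideanSpace ℝ (Fin 4)) :
    𝓕 (fun x : EuclideanSpace ℝ (Fin 4) =>
        gaussianSuperposition 1 rayCurve rayWeight ((‖x‖ ^ 2 : ℝ) : ℂ)) ξ =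
      gaussianSuperposition 1 segmentCurve segmentWeight ((‖ξ‖ ^ 2 : ℝ) : ℂ) := by
  rw [isGaussianWeight_ray.fourier_eq]
  refine gaussianSuperposition_congr (fun _ _ => rfl) (fun y _ => ?_) _
  simp only [segmentWeight, rayWeight, rayCurve]
  ring

theorem exists_schwartzMap_eigenProfile :
    ∃ f : 𝓢(EuclideanSpace ℝ (Fin 4), ℂ),
      (∀ x, f x = eigenProfile ((‖x‖ ^ 2 : ℝ) : ℂ)) ∧ 𝓕 (f : EuclideanSpace ℝ (Fin 4) → ℂ) = f := by
  obtain ⟨f₁, h₁⟩ := (isGaussianWeight_arc (ε := -1) (by norm_num)).exists_schwartzMap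
    (EuclideanSpace ℝ (Fin 4))
  obtain ⟨f₂, h₂⟩ := (isGaussianWeight_arc (ε := 1) (by norm_num)).exists_schwartzMap
    (EuclideanSpace ℝ (Fin 4))
  obtain ⟨f₃, h₃⟩ := isGaussianWeight_segment.exists_schwartzMap (EuclideanSpace ℝ (Fin 4))
  obtain ⟨f₄, h₄⟩ := isGaussianWeight_ray.exists_schwartzMap (EuclideanSpace ℝ (Fin 4))
  have e₁ : 𝓕 f₁ = f₂ := by
    ext ξ
    rw [SchwartzMap.fourier_coe, funext h₁, fourier_arc (Or.inr rfl), h₂, neg_neg]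
  have e₂ : 𝓕 f₂ = f₁ := by
    ext ξ
    rw [SchwartzMap.fourier_coe, funext h₂, fourier_arc (Or.inl rfl), h₁]
  have e₃ : 𝓕 f₃ = f₄ := by
    ext ξ
    rw [SchwartzMap.fourier_coe, funext h₃, fourier_segment, h₄]
  have e₄ : 𝓕 f₄ = f₃ := by
    ext ξ
    rw [SchwartzMap.fourier_coe, funext h₄, fourier_ray, h₃]
  refine ⟨f₁ + f₂ + f₃ + f₄, fun x => ?_, ?_⟩
  · simp only [add_apply, h₁, h₂, h₃, h₄, eigenProfile]
  · rw [← SchwartzMap.fourier_coe, FourierTransform.fourier_add, FourierTransform.fourier_add,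
      FourierTransform.fourier_add, e₁, e₂, e₃, e₄]
    congr 1
    abel

theorem analyticOnNhd_eigenProfile :
    AnalyticOnNhd ℝ (fun s : ℝ => eigenProfile s) (Ioi (-(1 / 4))) :=
  (((isGaussianWeight_arc (by norm_num)).analyticOnNhd.add
    (isGaussianWeight_arc (by norm_num)).analyticOnNhd).add
    isGaussianWeight_segment.analyticOnNhd).add isGaussianWeight_ray.analyticOnNhd

/-! ### Deformation of the contour -/

theorem integrableOn_vertical {g : ℂ → ℂ} {C c : ℝ} (hc : 0 < c)
    (hg : ContinuousOn g {z | 0 < z.im})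
    (hb : ∀ z : ℂ, |z.re| ≤ 1 → 1 / 2 ≤ z.im → ‖g z‖ ≤ C * Real.exp (-c * z.im))
    {x y₀ : ℝ} (hx : |x| ≤ 1) (hy₀ : 1 / 2 ≤ y₀) :
    IntegrableOn (fun y : ℝ => g (x + I * y)) (Ioi y₀) := by
  refine Integrable.mono' ((integrableOn_exp_mul_Ioi (neg_lt_zero.mpr hc) y₀).const_mul C) ?_
    ((ae_restrict_iff' measurableSet_Ioi).mpr (ae_of_all _ fun y hy => ?_))
  · refine ContinuousOn.aestronglyMeasurable ?_ measurableSet_Ioi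
    refine hg.comp (by fun_prop) fun y hy => ?_
    rw [mem_Ioi] at hy
    have : 0 < y := by linarith
    simpa using this
  · rw [mem_Ioi] at hy
    simpa using hb (x + I * y) (by simpa using hx) (by simpa using hy₀.trans hy.le)

theorem hasDerivAt_vertical {H g : ℂ → ℂ} (hH : ∀ z : ℂ, 0 < z.im → HasDerivAt H (g z) z)
    (x : ℝ) {y : ℝ} (hy : 0 < y) :
    HasDerivAt (fun y : ℝ => H (x + I * y)) (g (x + I * y) * I) y := by
  have h1 : HasDerivAt (fun w : ℂ => (x : ℂ) + I * w) I (y : ℂ) := by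
    simpa using ((hasDerivAt_id (y : ℂ)).const_mul I).const_add (x : ℂ)
  exact ((hH (x + I * y) (by simpa using hy)).comp (y : ℂ) h1).comp_ofReal

/-- A primitive of an exponentially decaying function has the same limit along all vertical
lines. -/
theorem exists_tendsto_vertical {H g : ℂ → ℂ} {C c : ℝ} (hc : 0 < c)
    (hH : ∀ z : ℂ, 0 < z.im → HasDerivAt H (g z) z) (hg : ContinuousOn g {z | 0 < z.im})
    (hb : ∀ z : ℂ, |z.re| ≤ 1 → 1 / 2 ≤ z.im → ‖g z‖ ≤ C * Real.exp (-c * z.im)) :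
    ∃ L : ℂ, ∀ x : ℝ, |x| ≤ 1 →
      Tendsto (fun y : ℝ => H (x + I * y)) atTop (𝓝 L) ∧
      ∀ y₀ : ℝ, 1 / 2 ≤ y₀ → (∫ y in Ioi y₀, g (x + I * y)) * I = L - H (x + I * y₀) := by
  have hlim : ∀ x : ℝ, |x| ≤ 1 → ∃ L, Tendsto (fun y : ℝ => H (x + I * y)) atTop (𝓝 L) :=
    fun x hx => ⟨_, tendsto_limUnder_of_hasDerivAt_of_integrableOn_Ioi (a := 1 / 2)
      (fun y hy => hasDerivAt_vertical hH x (by rw [mem_Ioi] at hy; linarith))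
      ((integrableOn_vertical hc hg hb hx le_rfl).mul_const I)⟩
  obtain ⟨L, hL⟩ := hlim 0 (by simp)
  have hsame : ∀ x : ℝ, |x| ≤ 1 → Tendsto (fun y : ℝ => H (x + I * y)) atTop (𝓝 L) := by
    intro x hx
    have h0 : Tendsto (fun y : ℝ => C * Real.exp (-c * y)) atTop (𝓝 0) := by
      have : Tendsto (fun y : ℝ => -c * y) atTop atBot :=
        tendsto_id.const_mul_atTop_of_neg (neg_lt_zero.mpr hc)
      simpa using (Real.tendsto_exp_atBot.comp this).const_mul C
    have hd : Tendsto (fun y : ℝ => H (x + I * y) - H ((0 : ℝ) + I * y)) atTop (𝓝 0) := by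
      refine squeeze_zero_norm' ?_ h0
      filter_upwards [eventually_ge_atTop (1 / 2)] with y hy
      -- Mean value inequality along the horizontal segment at height `y`: its length is at most 1
      -- and the derivative there is at most `C e^{-cy}`.
      have hconv : Convex ℝ (Icc (-1 : ℝ) 1 ×ℂ {y}) :=
        ((convex_Icc (-1 : ℝ) 1).linear_preimage reLm).inter
          ((convex_singleton y).linear_preimage imLm)
      have hmem : ∀ x : ℝ, |x| ≤ 1 → (x : ℂ) + I * y ∈ Icc (-1 : ℝ) 1 ×ℂ {y} := fun x hx =>
        mem_reProdIm.mpr ⟨by simpa using abs_le.mp hx, by simp⟩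
      have hC : 0 ≤ C * Real.exp (-c * y) := by
        have := (norm_nonneg _).trans (hb (I * y) (by simp) (by simpa using hy))
        simpa using this
      have := hconv.norm_image_sub_le_of_norm_hasDerivWithin_le (f := H) (f' := g)
        (C := C * Real.exp (-c * y))
        (fun z hz => (hH z (by
          have h2 := (mem_reProdIm.mp hz).2
          rw [mem_singleton_iff] at h2
          linarith)).hasDerivWithinAt)
        (fun z hz => by
          obtain ⟨h1, h2⟩ := mem_reProdIm.mp hz
          rw [mem_singleton_iff] at h2
          have := hb z (abs_le.mpr h1) (by linarith)
          rwa [h2] at this)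
        (hmem 0 (by simp)) (hmem x hx)
      refine this.trans (mul_le_of_le_one_right hC ?_)
      simpa using hx
    simpa using hd.add hL
  refine ⟨L, fun x hx => ⟨hsame x hx, fun y₀ hy₀ => ?_⟩⟩
  rw [← integral_mul_const]
  refine integral_Ioi_of_hasDerivAt_of_tendsto
    (hasDerivAt_vertical hH x (by linarith)).continuousAt.continuousWithinAt
    (fun y hy => hasDerivAt_vertical hH x (by rw [mem_Ioi] at hy; linarith))
    ((integrableOn_vertical hc hg hb hx hy₀).mul_const I) (hsame x hx)

theorem continuousOn_phi_I_mul : ContinuousOn (fun t : ℝ => phi (I * t)) (Ioi 0) := by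
  intro t ht
  have : 0 < (I * (t : ℂ)).im := by simpa using ht
  exact (ContinuousAt.comp (f := fun t : ℝ => I * (t : ℂ)) (differentiableAt_phi this).continuousAt
    (by fun_prop)).continuousWithinAt

theorem phi_I_mul_eq_psi {t : ℝ} (ht : 0 < t) : phi (I * t) = psi (I * ((1 / t : ℝ) : ℂ)) := by
  have ht' : (t : ℂ) ≠ 0 := ofReal_ne_zero.mpr ht.ne'
  rw [← phi_neg_inv (by simpa using ht)]
  congr 1
  push_cast
  field_simp
  rw [I_sq]

/-- For `t < 1` the identity `φ(it) = ψ(i/t)` moves the argument up to where `ψ` is small. -/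
theorem exists_norm_phi_I_mul_le :
    ∃ C : ℝ, 0 < C ∧ ∀ t : ℝ, 0 < t → ‖phi (I * t)‖ ≤ C * Real.exp (2 * Real.pi * t) := by
  obtain ⟨C, hC, h⟩ := exists_norm_phi_psi_le
  refine ⟨C, hC, fun t ht => ?_⟩
  rcases le_or_gt 1 t with h1 | h1
  · simpa using (h (I * t) (by simp) (by simpa using (by linarith : 1 / 2 ≤ t))).1
  · rw [phi_I_mul_eq_psi ht]
    have h2 : 1 / 2 ≤ (I * ((1 / t : ℝ) : ℂ)).im := by
      rw [I_mul_im, ofReal_re, div_le_div_iff₀ (by norm_num) ht]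
      linarith
    refine (h _ (by simp) h2).2.trans (mul_le_mul_of_nonneg_left (Real.exp_le_exp.mpr ?_) hC.le)
    have := Real.pi_pos
    have h3 : 0 ≤ 2 * Real.pi * t := by positivity
    nlinarith

theorem norm_laplace_le {C s t : ℝ}
    (h : ‖phi (I * t)‖ ≤ C * Real.exp (2 * Real.pi * t)) :
    ‖phi (I * t) * exp (-Real.pi * s * t)‖ ≤ C * Real.exp (-(Real.pi * (s - 2)) * t) := by
  have : ‖exp (-Real.pi * s * t : ℂ)‖ = Real.exp (-Real.pi * s * t) := by
    rw [Complex.norm_exp]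
    norm_cast
  rw [norm_mul, this]
  calc _ ≤ C * Real.exp (2 * Real.pi * t) * Real.exp (-Real.pi * s * t) := by gcongr
    _ = _ := by rw [mul_assoc, ← Real.exp_add]; ring_nf

theorem integrableOn_laplace {s : ℝ} (hs : 2 < s) :
    IntegrableOn (fun t : ℝ => phi (I * t) * exp (-Real.pi * s * t)) (Ioi 0) := by
  obtain ⟨C, hC, h⟩ := exists_norm_phi_I_mul_le
  have hc : -(Real.pi * (s - 2)) < 0 := by
    have := mul_pos Real.pi_pos (sub_pos.mpr hs)
    linarith
  refine Integrable.mono' ((integrableOn_exp_mul_Ioi hc 0).const_mul C) ?_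
    ((ae_restrict_iff' measurableSet_Ioi).mpr (ae_of_all _ fun t ht => norm_laplace_le (h t ht)))
  refine ContinuousOn.aestronglyMeasurable ?_ measurableSet_Ioi
  exact continuousOn_phi_I_mul.mul (by fun_prop)

/-- The Laplace transform as a difference of the values at the cusps `i∞` and `0` of a primitive
of `φ(z) e^{π i s z}`. -/
theorem integral_laplace_eq {s : ℝ} (hs : 2 < s) {H : ℂ → ℂ}
    (hH : ∀ z : ℂ, 0 < z.im → HasDerivAt H (phi z * exp (Real.pi * I * s * z)) z) {L₀ L₁ : ℂ}
    (h₀ : Tendsto (fun y : ℝ => H (-1 / (I * y))) atTop (𝓝 L₀))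
    (h₁ : Tendsto (fun y : ℝ => H (I * y)) atTop (𝓝 L₁)) :
    (∫ t in Ioi (0 : ℝ), phi (I * t) * exp (-Real.pi * s * t)) * I = L₁ - L₀ := by
  have hexp : ∀ t : ℝ, exp (-Real.pi * s * t : ℂ) = exp (Real.pi * I * s * (I * t)) := fun t => by
    congr 1
    linear_combination (-(Real.pi * s * t) : ℂ) * I_mul_I
  have hd : ∀ t ∈ Ioi (0 : ℝ), HasDerivAt (fun y : ℝ => H (I * y))
      (phi (I * t) * exp (-Real.pi * s * t) * I) t := fun t ht => by
    have := hasDerivAt_vertical hH 0 ht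
    simpa only [ofReal_zero, zero_add, hexp] using this
  have hlim : Tendsto (fun t : ℝ => H (I * t)) (𝓝[>] 0) (𝓝 L₀) := by
    refine (h₀.comp tendsto_inv_nhdsGT_zero).congr' ?_
    filter_upwards [self_mem_nhdsWithin] with t ht
    have ht : (t : ℂ) ≠ 0 := ofReal_ne_zero.mpr (ne_of_gt ht)
    simp only [Function.comp]
    congr 1
    push_cast
    field_simp
    rw [I_sq]
  -- The value of `H` at `0`, outside the half-plane, is arbitrary; it is replaced by the limit `L₀`
  -- to obtain continuity at the endpoint.
  have hd' : ∀ t ∈ Ioi (0 : ℝ), HasDerivAt (Function.update (fun y : ℝ => H (I * y)) 0 L₀)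
      (phi (I * t) * exp (-Real.pi * s * t) * I) t := fun t ht => by
    refine (hd t ht).congr_of_eventuallyEq ?_
    filter_upwards [Ioi_mem_nhds (mem_Ioi.mp ht)] with u hu
    exact Function.update_of_ne (ne_of_gt hu) _ _
  rw [← integral_mul_const]
  have key := integral_Ioi_of_hasDerivAt_of_tendsto
    (f := Function.update (fun y : ℝ => H (I * y)) 0 L₀) (m := L₁) ?_ hd'
    ((integrableOn_laplace hs).mul_const I) ?_
  · simpa using key
  · rw [continuousWithinAt_update_same]
    exact hlim.mono_left (nhdsWithin_mono _ fun t ht => lt_of_le_of_ne ht.1 (Ne.symm ht.2))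
  · refine h₁.congr' ?_
    filter_upwards [eventually_gt_atTop 0] with u hu
    exact (Function.update_of_ne (ne_of_gt hu) L₀ fun y : ℝ => H (I * y)).symm

theorem neg_four_mul_sin_sq (s : ℝ) :
    -4 * ((Real.sin (Real.pi * s / 2) : ℝ) : ℂ) ^ 2 =
      exp (Real.pi * I * s) + exp (-(Real.pi * I * s)) - 2 := by
  have h : exp (Real.pi * I * s) + exp (-(Real.pi * I * s)) = 2 * Complex.cos (Real.pi * s) := by
    rw [Complex.cos, mul_div_cancel₀ _ (two_ne_zero)]
    ring_nf
  have h2 : Complex.cos (Real.pi * s) = 2 * Complex.cos (Real.pi * s / 2) ^ 2 - 1 := by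
    rw [← Complex.cos_two_mul]
    ring_nf
  rw [h, h2, Complex.cos_sq', ofReal_sin]
  push_cast
  ring

/-- The contour deformation is carried out with a primitive `H` of `φ(z) e^{πisz}`, which exists
because the half-plane is convex. With `L₀`, `L₁` its limits at the cusps `0` and `i∞`, all values
of `H` at `i` and `±1 + i` cancel, leaving `(e^{πis} + e^{-πis} - 2)(L₁ - L₀)`. -/
theorem eigenProfile_eq_laplace {s : ℝ} (hs : 2 < s) :
    eigenProfile s = -4 * I * ((Real.sin (Real.pi * s / 2) : ℝ) : ℂ) ^ 2 *
      ∫ t in Ioi (0 : ℝ), phi (I * t) * exp (-Real.pi * s * t) := by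
  set g : ℂ → ℂ := fun z => phi z * exp (Real.pi * I * s * z) with hg
  have hopen : IsOpen {z : ℂ | 0 < z.im} := isOpen_lt continuous_const continuous_im
  have hgd : ∀ z : ℂ, 0 < z.im → DifferentiableAt ℂ g z := fun z hz =>
    (differentiableAt_phi hz).mul (by fun_prop)
  obtain ⟨H, hH⟩ := (convex_halfSpace_im_gt 0).exists_forall_hasDerivWithinAt
    fun z hz => (hgd z hz).differentiableWithinAt
  have hH : ∀ z : ℂ, 0 < z.im → HasDerivAt H (g z) z := fun z hz =>
    (hH z hz).hasDerivAt (hopen.mem_nhds hz)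
  set k : ℂ → ℂ := fun w => psi w * exp (Real.pi * I * s * (-1 / w)) / w ^ 2 with hk
  have hne : ∀ w : ℂ, 0 < w.im → w ≠ 0 := fun w hw h => by simp [h] at hw
  have hK : ∀ w : ℂ, 0 < w.im → HasDerivAt (fun w => H (-1 / w)) (k w) w := fun w hw => by
    have h1 : HasDerivAt (fun w : ℂ => -1 / w) (1 / w ^ 2) w := by
      refine ((hasDerivAt_const w (-1 : ℂ)).div (hasDerivAt_id w) (hne w hw)).congr_deriv ?_
      simp
    refine ((hH _ (im_neg_one_div_pos hw)).comp w h1).congr_deriv ?_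
    simp only [hg, hk, phi_neg_inv hw]
    ring
  have hkc : ContinuousOn k {z | 0 < z.im} := fun w hw => by
    have h1 := (differentiableAt_psi hw).continuousAt
    have h2 : ContinuousAt (fun w : ℂ => exp (Real.pi * I * s * (-1 / w))) w := by
      have := hne w hw
      fun_prop (disch := assumption)
    exact ((h1.mul h2).div (continuousAt_id.pow 2) (pow_ne_zero _ (hne w hw))).continuousWithinAt
  obtain ⟨C, hC, hb⟩ := exists_norm_phi_psi_le
  -- Here `s > 2` is essential: `e^{-πsy}` must beat the growth `e^{2πy}` of `φ`.
  have hc : 0 < Real.pi * (s - 2) := mul_pos Real.pi_pos (by linarith)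
  have hgc : ContinuousOn g {z | 0 < z.im} :=
    fun z hz => (hgd z hz).continuousAt.continuousWithinAt
  have hgb : ∀ z : ℂ, |z.re| ≤ 1 → 1 / 2 ≤ z.im →
      ‖g z‖ ≤ C * Real.exp (-(Real.pi * (s - 2)) * z.im) := fun z hre him => by
    rw [hg, norm_mul, norm_exp_pi_mul_I_mul]
    calc _ ≤ C * Real.exp (2 * Real.pi * z.im) *
          Real.exp (-Real.pi * ((s : ℂ).re * z.im + (s : ℂ).im * z.re)) := by
          gcongr
          exact (hb z hre him).1
      _ = _ := by
          rw [mul_assoc, ← Real.exp_add]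
          simp only [ofReal_re, ofReal_im]
          ring_nf
  obtain ⟨L₁, hL₁⟩ := exists_tendsto_vertical hc hH hgc hgb
  obtain ⟨L₀, hL₀⟩ := exists_tendsto_vertical (C := 4 * C) Real.pi_pos hK hkc
    fun z hre him => by
      have h1 : ‖psi z * exp (Real.pi * I * s * (-1 / z))‖ ≤ C * Real.exp (-Real.pi * z.im) := by
        rw [norm_mul, norm_exp_pi_mul_I_mul]
        refine (mul_le_of_le_one_right (norm_nonneg _) (Real.exp_le_one_iff.mpr ?_)).trans
          (hb z hre him).2
        have h2 := mul_pos (by linarith : 0 < s) (im_neg_one_div_pos (by linarith : 0 < z.im))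
        simp only [ofReal_re, ofReal_im, zero_mul, add_zero]
        nlinarith [Real.pi_pos]
      have h2 := norm_div_vertical_sq_le (x := z.re) him (by positivity) h1
      rw [mul_comm I, re_add_im] at h2
      exact h2.trans_eq (mul_assoc _ _ _).symm
  -- Translating the arc by `-ε` turns `φ(z+1)` into `φ` by 2-periodicity and produces the factor
  -- `e^{πisε}`. The translated arc runs from the cusp `0` to `-ε + i`.
  have harc : ∀ ε : ℝ, ε ^ 2 = 1 →
      gaussianSuperposition (1 / 2) (arcCurve ε) (arcWeight ε) s =
        exp (Real.pi * I * s * ε) * (H (-ε + I) - L₀) := by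
    intro ε hε
    have hε1 : |ε / 2| ≤ 1 := by rw [abs_le]; constructor <;> nlinarith
    have h1 := (hL₀ (ε / 2) hε1).2 (1 / 2) le_rfl
    have h2 : -1 / (((ε / 2 : ℝ) : ℂ) + I * ((1 / 2 : ℝ) : ℂ)) = -ε + I := by
      rw [div_eq_iff (vertical_ne_zero _ (by norm_num))]
      have hε' : (ε : ℂ) ^ 2 = 1 := by exact_mod_cast hε
      push_cast
      linear_combination (1 / 2 : ℂ) * hε' - (1 / 2 : ℂ) * I_sq
    rw [h2] at h1
    rw [← neg_sub, ← h1, gaussianSuperposition, ← integral_mul_const, ← integral_neg,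
      ← integral_const_mul]
    refine integral_congr_ae (ae_of_all _ fun y => ?_)
    simp only [arcWeight, arcCurve, hk]
    rw [mul_sub, sub_eq_add_neg, Complex.exp_add]
    push_cast
    ring_nf
  have hseg : gaussianSuperposition 1 segmentCurve segmentWeight s = 2 * (L₀ - H I) := by
    have h1 := (hL₀ 0 (by simp)).2 1 (by norm_num)
    have h2 : -1 / (((0 : ℝ) : ℂ) + I * ((1 : ℝ) : ℂ)) = I := by
      simp [neg_div]
    rw [h2] at h1
    rw [← h1, gaussianSuperposition, ← integral_mul_const, ← integral_const_mul]
    refine integral_congr_ae (ae_of_all _ fun y => ?_)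
    simp only [segmentWeight, segmentCurve, hk, ofReal_zero, zero_add]
    ring
  -- The weight `-2ψ` is split back into `φ(z+1) + φ(z-1) - 2φ(z)`, and each term is integrated
  -- along its own vertical line.
  have hray : gaussianSuperposition 1 rayCurve rayWeight s =
      exp (-(Real.pi * I * s)) * (L₁ - H (1 + I)) + exp (Real.pi * I * s) * (L₁ - H (-1 + I)) -
        2 * (L₁ - H I) := by
    have hi : ∀ x : ℝ, |x| ≤ 1 →
        Integrable (fun y : ℝ => g (x + I * y) * I) (volume.restrict (Ioi 1)) :=
      fun x hx => (integrableOn_vertical hc hgc hgb hx (by norm_num)).mul_const I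
    have hi1 : Integrable (fun y : ℝ => exp (-(Real.pi * I * s)) * (g (1 + I * y) * I))
        (volume.restrict (Ioi 1)) := by simpa using (hi 1 (by simp)).const_mul _
    have hi2 : Integrable (fun y : ℝ => exp (Real.pi * I * s) * (g (-1 + I * y) * I))
        (volume.restrict (Ioi 1)) := by simpa using (hi (-1) (by simp)).const_mul _
    have h1 := (hL₁ 1 (by simp)).2 1 (by norm_num)
    have h2 := (hL₁ (-1) (by simp)).2 1 (by norm_num)
    have h3 := (hL₁ 0 (by simp)).2 1 (by norm_num)
    simp only [ofReal_one, ofReal_neg, ofReal_zero, zero_add, mul_one] at h1 h2 h3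
    rw [← h1, ← h2, ← h3, gaussianSuperposition, ← integral_mul_const, ← integral_mul_const,
      ← integral_mul_const, ← integral_const_mul, ← integral_const_mul, ← integral_const_mul,
      ← integral_add, ← integral_sub]
    · refine setIntegral_congr_fun measurableSet_Ioi fun y hy => ?_
      have hy : 0 < (I * (y : ℂ)).im := by
        rw [mem_Ioi] at hy
        simpa using zero_lt_one.trans hy
      have e1 := phi_add_one hy
      have e2 := phi_sub_one hy
      simp only [rayWeight, rayCurve, hg]
      rw [show (1 : ℂ) + I * y = I * y + 1 by ring, show (-1 : ℂ) + I * y = I * y - 1 by ring, e2,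
        e1, mul_add, mul_sub, mul_one, Complex.exp_add, Complex.exp_sub, Complex.exp_neg]
      have := Complex.exp_ne_zero (Real.pi * I * s)
      field_simp
      ring
    · exact hi1.add hi2
    · simpa using (hi 0 (by simp)).const_mul 2
    · exact hi1
    · exact hi2
  have hlap := integral_laplace_eq hs hH
    (by simpa using (hL₀ 0 (by simp)).1) (by simpa using (hL₁ 0 (by simp)).1)
  rw [eigenProfile, harc (-1) (by norm_num), harc 1 (by norm_num), hseg, hray,
    show ∀ a b c : ℂ, -4 * a * b * c = -4 * b * (c * a) from fun a b c => by ring, hlap,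
    neg_four_mul_sin_sq]
  push_cast
  rw [neg_neg, mul_neg_one, mul_one]
  ring

/-! ### Reality and sign of the eigenfunction -/

/-- The Laplace transform of `t ↦ φ(it)`, as a real number. -/
def laplacePhi (s : ℝ) : ℝ :=
  ∫ t in Ioi (0 : ℝ), (phi (I * t)).re * Real.exp (-Real.pi * s * t)

/-- The radial profile of the eigenfunction as a real function of the squared norm. -/
def realProfile (s : ℝ) : ℝ := (I * eigenProfile s).re

theorem ofReal_laplacePhi (s : ℝ) :
    (laplacePhi s : ℂ) = ∫ t in Ioi (0 : ℝ), phi (I * t) * exp (-Real.pi * s * t) := by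
  rw [laplacePhi, ← integral_complex_ofReal]
  refine setIntegral_congr_fun measurableSet_Ioi fun t ht => ?_
  simp only [ofReal_mul, ofReal_phi_I_mul_re (mem_Ioi.mp ht)]
  push_cast
  rfl

theorem I_mul_eigenProfile_eq {s : ℝ} (hs : 2 < s) :
    I * eigenProfile s = ((4 * Real.sin (Real.pi * s / 2) ^ 2 * laplacePhi s : ℝ) : ℂ) := by
  rw [eigenProfile_eq_laplace hs, ← ofReal_laplacePhi]
  push_cast
  linear_combination (-4 * Complex.sin (Real.pi * s / 2) ^ 2 * laplacePhi s) * I_mul_I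

theorem realProfile_eq {s : ℝ} (hs : 2 < s) :
    realProfile s = 4 * Real.sin (Real.pi * s / 2) ^ 2 * laplacePhi s := by
  rw [realProfile, I_mul_eigenProfile_eq hs, ofReal_re]

theorem analyticOnNhd_I_mul_eigenProfile :
    AnalyticOnNhd ℝ (fun s : ℝ => I * eigenProfile s) (Ioi (-(1 / 4))) :=
  analyticOnNhd_const.mul analyticOnNhd_eigenProfile

/-- The imaginary part is analytic and vanishes for `s > 2`, hence everywhere on `(-1/4, ∞)`. -/
theorem I_mul_eigenProfile_eq_realProfile {s : ℝ} (hs : 0 ≤ s) :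
    I * eigenProfile s = realProfile s := by
  have him : AnalyticOnNhd ℝ (fun s : ℝ => (I * eigenProfile s).im) (Ioi (-(1 / 4))) :=
    fun t ht => (imCLM.analyticAt _).comp (analyticOnNhd_I_mul_eigenProfile t ht)
  have hz : EqOn (fun s : ℝ => (I * eigenProfile s).im) 0 (Ioi (-(1 / 4))) := by
    refine him.eqOn_of_preconnected_of_eventuallyEq analyticOnNhd_const isPreconnected_Ioi
      (z₀ := 3) (by rw [mem_Ioi]; norm_num) ?_
    filter_upwards [Ioi_mem_nhds (by norm_num : (2 : ℝ) < 3)] with t ht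
    rw [I_mul_eigenProfile_eq ht, ofReal_im]
    rfl
  exact Complex.ext rfl (hz (by rw [mem_Ioi]; linarith : s ∈ Ioi (-(1 / 4))))

theorem integrableOn_laplacePhi {s : ℝ} (hs : 2 < s) :
    IntegrableOn (fun t : ℝ => (phi (I * t)).re * Real.exp (-Real.pi * s * t)) (Ioi 0) := by
  refine (integrableOn_laplace hs).re.congr
    ((ae_restrict_iff' measurableSet_Ioi).mpr (ae_of_all _ fun t ht => ?_))
  have h : (-Real.pi * s * t : ℂ) = ((-Real.pi * s * t : ℝ) : ℂ) := by push_cast; rfl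
  simp only [RCLike.re_to_complex, h, ← ofReal_exp, re_mul_ofReal]

theorem laplacePhi_nonneg (s : ℝ) : 0 ≤ laplacePhi s :=
  setIntegral_nonneg measurableSet_Ioi fun _ ht =>
    mul_nonneg (phi_I_mul_re_nonneg ht) (Real.exp_pos _).le

theorem realProfile_nonneg_of_two_lt {s : ℝ} (hs : 2 < s) : 0 ≤ realProfile s := by
  rw [realProfile_eq hs]
  have := laplacePhi_nonneg s
  positivity

theorem exists_laplacePhi_le :
    ∃ C : ℝ, 0 < C ∧ ∀ s : ℝ, 2 < s → laplacePhi s ≤ C / (Real.pi * (s - 2)) := by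
  obtain ⟨C, hC, h⟩ := exists_norm_phi_I_mul_le
  refine ⟨C, hC, fun s hs => ?_⟩
  have hc : -(Real.pi * (s - 2)) < 0 := neg_lt_zero.mpr (mul_pos Real.pi_pos (by linarith))
  calc laplacePhi s ≤ ∫ t in Ioi (0 : ℝ), C * Real.exp (-(Real.pi * (s - 2)) * t) := by
        refine setIntegral_mono_on (integrableOn_laplacePhi hs)
          ((integrableOn_exp_mul_Ioi hc 0).const_mul C) measurableSet_Ioi fun t ht => ?_
        calc _ ≤ C * Real.exp (2 * Real.pi * t) * Real.exp (-Real.pi * s * t) := by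
              gcongr
              exact (re_le_norm _).trans (h t ht)
          _ = _ := by rw [mul_assoc, ← Real.exp_add]; ring_nf
    _ = _ := by
        rw [integral_const_mul, integral_exp_mul_Ioi hc, mul_zero, Real.exp_zero, neg_div_neg_eq]
        ring

theorem exists_le_laplacePhi :
    ∃ c : ℝ, 0 < c ∧ ∀ s : ℝ, 2 < s → s ≤ 3 → c / (Real.pi * (s - 2)) ≤ laplacePhi s := by
  obtain ⟨c, T, hc, hT, h⟩ := exists_le_phi_I_mul_re
  -- For `s ≤ 3` one has `e^{-π(s-2)T} ≥ e^{-πT}`, which makes the constant independent of `s`.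
  refine ⟨c * Real.exp (-(Real.pi * T)), by positivity, fun s hs hs3 => ?_⟩
  have hb : -(Real.pi * (s - 2)) < 0 := neg_lt_zero.mpr (mul_pos Real.pi_pos (by linarith))
  have hpi := Real.pi_pos
  have hs2 : 0 < s - 2 := by linarith
  calc c * Real.exp (-(Real.pi * T)) / (Real.pi * (s - 2))
      ≤ c * Real.exp (-(Real.pi * (s - 2)) * T) / (Real.pi * (s - 2)) := by
        gcongr
        nlinarith [mul_pos hpi (by linarith : 0 < T)]
    _ = ∫ t in Ioi T, c * Real.exp (-(Real.pi * (s - 2)) * t) := by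
        rw [integral_const_mul, integral_exp_mul_Ioi hb, neg_div_neg_eq]
        ring
    _ ≤ ∫ t in Ioi T, (phi (I * t)).re * Real.exp (-Real.pi * s * t) := by
        refine setIntegral_mono_on ((integrableOn_exp_mul_Ioi hb T).const_mul c)
          ((integrableOn_laplacePhi hs).mono_set (Ioi_subset_Ioi (by linarith)))
          measurableSet_Ioi fun t ht => ?_
        calc _ = c * Real.exp (2 * Real.pi * t) * Real.exp (-Real.pi * s * t) := by
              rw [mul_assoc, ← Real.exp_add]; ring_nf
          _ ≤ _ := by
              gcongr
              exact h t (mem_Ioi.mp ht).le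
    _ ≤ laplacePhi s := by
        refine setIntegral_mono_set (integrableOn_laplacePhi hs) ?_
          (Ioi_subset_Ioi (by linarith)).eventuallyLE
        exact (ae_restrict_iff' measurableSet_Ioi).mpr (ae_of_all _ fun t ht =>
          mul_nonneg (phi_I_mul_re_nonneg ht) (Real.exp_pos _).le)

theorem sin_sq_pi_mul_half (s : ℝ) :
    Real.sin (Real.pi * s / 2) ^ 2 = Real.sin (Real.pi * (s - 2) / 2) ^ 2 := by
  rw [show Real.pi * s / 2 = Real.pi * (s - 2) / 2 + Real.pi by ring, Real.sin_add_pi, neg_sq]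

theorem exists_realProfile_le :
    ∃ C : ℝ, ∀ s : ℝ, 2 < s → realProfile s ≤ C * (s - 2) := by
  obtain ⟨C, hC, h⟩ := exists_laplacePhi_le
  refine ⟨Real.pi * C, fun s hs => ?_⟩
  have hs2 : 0 < s - 2 := by linarith
  have hpi := Real.pi_pos
  rw [realProfile_eq hs, sin_sq_pi_mul_half]
  have hsin : Real.sin (Real.pi * (s - 2) / 2) ^ 2 ≤ (Real.pi * (s - 2) / 2) ^ 2 := by
    rw [sq_le_sq, abs_of_pos (by positivity : 0 < Real.pi * (s - 2) / 2)]
    exact Real.abs_sin_le_abs.trans_eq (abs_of_pos (by positivity))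
  calc _ ≤ 4 * (Real.pi * (s - 2) / 2) ^ 2 * (C / (Real.pi * (s - 2))) := by
        gcongr
        · exact laplacePhi_nonneg s
        · exact h s hs
    _ = _ := by field_simp; norm_num

theorem exists_le_realProfile :
    ∃ c : ℝ, 0 < c ∧ ∀ s : ℝ, 2 < s → s ≤ 3 → c * (s - 2) ≤ realProfile s := by
  obtain ⟨c, hc, h⟩ := exists_le_laplacePhi
  have hpi := Real.pi_pos
  refine ⟨4 * c / Real.pi, by positivity, fun s hs hs3 => ?_⟩
  have hs2 : 0 < s - 2 := by linarith
  rw [realProfile_eq hs, sin_sq_pi_mul_half]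
  -- Jordan's inequality `sin x ≥ 2x/π` on `[0, π/2]`; this is why `s ≤ 3` is required.
  have hsin : s - 2 ≤ Real.sin (Real.pi * (s - 2) / 2) := by
    have := Real.mul_le_sin (x := Real.pi * (s - 2) / 2) (by positivity) (by nlinarith)
    rwa [show 2 / Real.pi * (Real.pi * (s - 2) / 2) = s - 2 by field_simp] at this
  calc 4 * c / Real.pi * (s - 2) = 4 * (s - 2) ^ 2 * (c / (Real.pi * (s - 2))) := by field_simp
    _ ≤ _ := by
        gcongr
        exact h s hs hs3

theorem differentiableAt_realProfile {s : ℝ} (hs : 0 ≤ s) : DifferentiableAt ℝ realProfile s :=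
  ((reCLM.analyticAt _).comp (analyticOnNhd_I_mul_eigenProfile s
    (by rw [mem_Ioi]; linarith))).differentiableAt

theorem realProfile_two : realProfile 2 = 0 := by
  obtain ⟨C, h⟩ := exists_realProfile_le
  have h1 : Tendsto realProfile (𝓝[>] 2) (𝓝 (realProfile 2)) :=
    (differentiableAt_realProfile zero_le_two).continuousAt.tendsto.mono_left nhdsWithin_le_nhds
  have h2 : Tendsto (fun s : ℝ => C * (s - 2)) (𝓝[>] 2) (𝓝 0) := by
    have : Tendsto (fun s : ℝ => C * (s - 2)) (𝓝 2) (𝓝 (C * (2 - 2))) :=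
      Continuous.tendsto (by fun_prop) 2
    rw [sub_self, mul_zero] at this
    exact this.mono_left nhdsWithin_le_nhds
  refine tendsto_nhds_unique h1 (tendsto_of_tendsto_of_tendsto_of_le_of_le' tendsto_const_nhds h2
    ?_ ?_)
  · filter_upwards [self_mem_nhdsWithin] with s hs using realProfile_nonneg_of_two_lt hs
  · filter_upwards [self_mem_nhdsWithin] with s hs using h s hs

theorem realProfile_nonneg {s : ℝ} (hs : 2 ≤ s) : 0 ≤ realProfile s := by
  rcases hs.eq_or_lt with rfl | hs
  · exact realProfile_two.ge
  · exact realProfile_nonneg_of_two_lt hs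

/-- The profile changes sign at `2`: it vanishes there with positive derivative. -/
theorem exists_realProfile_neg {m : ℝ} (hm : m < 2) :
    ∃ s, m ≤ s ∧ s < 2 ∧ realProfile s < 0 := by
  by_contra! hcon
  -- Without negative values just below 2, the zero at 2 would be a local minimum with zero
  -- derivative, contradicting the lower bound `c (s-2)` on the right.
  have hmin : IsLocalMin realProfile 2 := by
    filter_upwards [Ioi_mem_nhds hm] with s hs
    rw [realProfile_two]
    rcases lt_or_ge s 2 with h | h
    · exact hcon s (mem_Ioi.mp hs).le h
    · exact realProfile_nonneg h
  have hd := (differentiableAt_realProfile zero_le_two).hasDerivAt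
  rw [hmin.deriv_eq_zero, hasDerivAt_iff_isLittleO] at hd
  obtain ⟨c, hc, h⟩ := exists_le_realProfile
  obtain ⟨δ, hδ, hball⟩ := Metric.eventually_nhds_iff.mp (hd.def (half_pos hc))
  have hmin0 : 0 < min (δ / 2) 1 := lt_min (by linarith) one_pos
  have h1 := hball (y := 2 + min (δ / 2) 1) (by
    rw [Real.dist_eq, add_sub_cancel_left, abs_of_pos hmin0]
    exact (min_le_left _ _).trans_lt (by linarith))
  have h2 := h (2 + min (δ / 2) 1) (by linarith) (by linarith [min_le_right (δ / 2) 1])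
  simp only [realProfile_two, sub_zero, smul_zero, add_sub_cancel_left, Real.norm_eq_abs,
    abs_of_pos hmin0] at h1 h2
  have h3 := le_abs_self (realProfile (2 + min (δ / 2) 1))
  nlinarith

theorem signRadius_eq_sqrt_two {f : EuclideanSpace ℝ (Fin 4) → ℝ}
    (hf : ∀ x, f x = realProfile (‖x‖ ^ 2)) : signRadius f = √2 := by
  have hmem : √2 ∈ {M : ℝ | 0 ≤ M ∧ ∀ x, M ≤ ‖x‖ → 0 ≤ f x} := by
    refine ⟨Real.sqrt_nonneg 2, fun x hx => ?_⟩
    rw [hf]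
    exact realProfile_nonneg ((Real.sqrt_le_left (norm_nonneg x)).mp hx)
  refine le_antisymm (csInf_le ⟨0, fun M hM => hM.1⟩ hmem) (le_csInf ⟨_, hmem⟩ fun M hM => ?_)
  by_contra! hlt
  have hM2 : M ^ 2 < 2 := (Real.lt_sqrt hM.1).mp hlt
  obtain ⟨s, hs, -, hneg⟩ := exists_realProfile_neg hM2
  have hs0 : 0 ≤ s := (sq_nonneg M).trans hs
  have hnorm : ‖EuclideanSpace.single (0 : Fin 4) (√s)‖ = √s := by
    rw [PiLp.norm_single, Real.norm_of_nonneg (Real.sqrt_nonneg s)]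
  have := hM.2 (EuclideanSpace.single 0 (√s)) (by rw [hnorm]; exact Real.le_sqrt_of_sq_le hs)
  rw [hf, hnorm, Real.sq_sqrt hs0] at this
  linarith

/-! ### The eigenfunction -/

theorem two_lt_sq_of_sqrt_two_lt {r : ℝ} (hr : √2 < r) : 2 < r ^ 2 :=
  (Real.sqrt_lt' ((Real.sqrt_nonneg 2).trans_lt hr)).mp hr

theorem laplaceIntegrand_eq (r t : ℝ) :
    laplaceIntegrand r t = phi (I * t) * exp (-Real.pi * ((r ^ 2 : ℝ) : ℂ) * t) := by
  rw [laplaceIntegrand]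
  push_cast
  rfl

theorem isAnalyticContinuation_eigenProfile :
    IsAnalyticContinuation fun r : ℝ => eigenProfile ((r ^ 2 : ℝ) : ℂ) where
  analytic r _ := by
    have h1 : AnalyticAt ℝ (fun r : ℝ => r ^ 2) r := analyticAt_id.pow 2
    have h2 : -(1 / 4) < r ^ 2 := by linarith [sq_nonneg r]
    exact AnalyticAt.comp (g := fun s : ℝ => eigenProfile s) (f := fun r : ℝ => r ^ 2)
      (analyticOnNhd_eigenProfile (r ^ 2) h2) h1
  eq_integral r hr := by
    simp only [laplaceIntegrand_eq]
    exact eigenProfile_eq_laplace (two_lt_sq_of_sqrt_two_lt hr)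

/-- Identity theorem on the connected set `[0, ∞)`: two continuations agree near `√2 + 1`, where
both are given by the integral. -/
theorem IsAnalyticContinuation.eqOn {a b : ℝ → ℂ} (ha : IsAnalyticContinuation a)
    (hb : IsAnalyticContinuation b) : EqOn b a (Ici 0) := by
  refine hb.analytic.eqOn_of_preconnected_of_eventuallyEq ha.analytic isPreconnected_Ici
    (z₀ := √2 + 1) (by rw [mem_Ici]; positivity) ?_
  filter_upwards [Ioi_mem_nhds (by linarith : √2 < √2 + 1)] with r hr
  rw [ha.eq_integral r hr, hb.eq_integral r hr]

theorem exists_schwartzMap_realProfile :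
    ∃ f : 𝓢(EuclideanSpace ℝ (Fin 4), ℝ), (∀ x, f x = realProfile (‖x‖ ^ 2)) ∧
      𝓕 (fun x => (f x : ℂ)) = fun x => (f x : ℂ) := by
  obtain ⟨g, hg, hfourier⟩ := exists_schwartzMap_eigenProfile
  refine ⟨SchwartzMap.postcompCLM reCLM (I • g), fun x => ?_, ?_⟩
  · simp [realProfile, hg]
  · have h : (fun x => ((SchwartzMap.postcompCLM reCLM (I • g) x : ℝ) : ℂ)) =
        ((I • g : 𝓢(EuclideanSpace ℝ (Fin 4), ℂ)) : EuclideanSpace ℝ (Fin 4) → ℂ) := by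
      ext x
      have := I_mul_eigenProfile_eq_realProfile (sq_nonneg ‖x‖)
      rw [← hg, realProfile, ← hg] at this
      simpa using this.symm
    have hg' : 𝓕 g = g := by
      ext x
      rw [SchwartzMap.fourier_coe, hfourier]
    rw [h, ← SchwartzMap.fourier_coe, FourierTransform.fourier_smul, hg']

end FourDimEigenfunction

end

theorem mainTheorem1 :
    FourDimEigenfunction.IsWeaklyHolomorphicModularForm (CongruenceSubgroup.Gamma 2) 0
      (fun z : UpperHalfPlane => FourDimEigenfunction.phi z) ∧
    (∀ z : ℂ, 0 < z.im →
      FourDimEigenfunction.phi (z + 1) - FourDimEigenfunction.phi z =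
        FourDimEigenfunction.phi (-1 / z) * Complex.I ^ (-2 : ℤ)) ∧
    (∀ r : ℝ, √2 < r →
      MeasureTheory.IntegrableOn (FourDimEigenfunction.laplaceIntegrand r) (Set.Ioi 0)) ∧
    ∃ a : ℝ → ℂ,
      FourDimEigenfunction.IsAnalyticContinuation a ∧
      (∀ b : ℝ → ℂ, FourDimEigenfunction.IsAnalyticContinuation b →
        Set.EqOn b a (Set.Ici 0)) ∧
      ∃ f : 𝓢(EuclideanSpace ℝ (Fin 4), ℝ),
        (∀ x, (f x : ℂ) = Complex.I * a ‖x‖) ∧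
        𝓕 (fun x => (f x : ℂ)) = (fun x => (f x : ℂ)) ∧
        FourDimEigenfunction.signRadius f = √2 := by
  open FourDimEigenfunction in
  refine ⟨isWeaklyHolomorphicModularForm_phi, fun z hz => phi_add_one_sub hz, fun r hr => ?_,
    _, isAnalyticContinuation_eigenProfile,
    fun b hb => isAnalyticContinuation_eigenProfile.eqOn hb, ?_⟩
  · rw [funext (laplaceIntegrand_eq r)]
    exact integrableOn_laplace (two_lt_sq_of_sqrt_two_lt hr)
  · obtain ⟨f, hf, hfourier⟩ := exists_schwartzMap_realProfile
    refine ⟨f, fun x => ?_, hfourier, signRadius_eq_sqrt_two hf⟩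
    rw [hf, I_mul_eigenProfile_eq_realProfile (sq_nonneg _)]
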